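/- For a finite poset $P$ and an integer $m \geq 0$, let $\mathrm{PP}^m(P)$ be the set of $P$-partitions of height $m$, i.e., maps $\pi\colon P\to\{0,1,\ldots,m\}$ with $\pi(p)\leq\pi(q)$ whenever $p\leq q$. For $p\in P$ the piecewise-linear toggle $\tau_p\colon \mathrm{PP}^m(P)\to\mathrm{PP}^m(P)$ replaces the value $\pi(p)$ by \[\min\{\pi(r)\colon p\lessdot r\}+\max\{\pi(r)\colon r\lessdot p\}-\pi(p)\] (with the conventions $\min\varnothing=m$ and $\max\varnothing=0$) and leaves all other values unchanged. Rowmotion is $\mathrm{Row}:=\tau_{p_1}\cdot\tau_{p_2}\cdots\tau_{p_N}$, where $p_1,\ldots,p_N$ is any linear extension of $P$ (so the toggle at $p_N$ is applied first); it does not depend on the choice of linear extension. Let $n\times n$ denote the poset $\{(i,j)\colon 1\leq i,j\leq n\}$ with $(i,j)\leq(i',j')$ if and only if $i'\leq i$ and $j'\leq j$, so that $\mathrm{PP}^m(n\times n)$ is the set of $n \times n$ plane partitions $\pi=(\pi_{i,j})$ with entries at most $m$. Let $\mathrm{Tr}(\pi)_{i,j}:=\pi_{j,i}$ be transposition. Let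 $\triangledown_{n-1}$ denote the induced subposet $\{(i,j)\colon i,j\geq 1,\ i+j\leq n\}$ of $n \times n$, which is isomorphic to the root poset of type $A_{n-1}$. \textbf{Lemma.} For all integers $n\geq 1$ and $M\geq 0$ there is a $\mathrm{Row}$-equivariant bijection between $\mathrm{PP}^{M}(\triangledown_{n-1})$ and the set of all $\pi\in\mathrm{PP}^{2M}(n\times n)$ for which $\mathrm{Tr}\cdot\mathrm{Row}^{n}(\pi)=\pi$. -/

import Mathlib

/-- A `P`-partition of height `m`: a weakly order-preserving map from `P` to `{0, 1, …, m}`. -/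
@[ext]
structure PPartition (P : Type*) [PartialOrder P] (m : ℕ) where
  toFun : P → ℕ
  monotone : Monotone toFun
  le_height : ∀ p, toFun p ≤ m

namespace PPartition

section Poset

variable {P : Type*} [PartialOrder P] [Fintype P] {m : ℕ}

open Classical in
/-- The minimum of the `π r` over all `r` covering `p`, with `min ∅ = m`. -/
noncomputable def minAbove (π : PPartition P m) (p : P) : ℕ :=
  if h : (Finset.univ.filter fun r => p ⋖ r).Nonempty then
    (Finset.univ.filter fun r => p ⋖ r).inf' h π.toFun
  else m

open Classical in
/-- The maximum of the `π r` over all `r` covered by `p`, with `max ∅ = 0`. -/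
noncomputable def maxBelow (π : PPartition P m) (p : P) : ℕ :=
  if h : (Finset.univ.filter fun r => r ⋖ p).Nonempty then
    (Finset.univ.filter fun r => r ⋖ p).sup' h π.toFun
  else 0

theorem minAbove_le_height (π : PPartition P m) (p : P) : π.minAbove p ≤ m := by
  unfold minAbove
  split_ifs with h
  · obtain ⟨r, hr⟩ := h
    exact (Finset.inf'_le _ hr).trans (π.le_height r)
  · exact le_rfl

theorem minAbove_le (π : PPartition P m) {p q : P} (h : p ⋖ q) : π.minAbove p ≤ π.toFun q := by
  classical
  have hq : q ∈ Finset.univ.filter fun r => p ⋖ r := by simpa using h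
  unfold minAbove
  rw [dif_pos ⟨q, hq⟩]
  exact Finset.inf'_le _ hq

theorem le_minAbove (π : PPartition P m) (p : P) : π.toFun p ≤ π.minAbove p := by
  unfold minAbove
  split_ifs with h
  · refine Finset.le_inf' _ _ fun r hr => π.monotone ?_
    simp only [Finset.mem_filter, Finset.mem_univ, true_and] at hr
    exact hr.le
  · exact π.le_height p

theorem le_maxBelow (π : PPartition P m) {p q : P} (h : q ⋖ p) : π.toFun q ≤ π.maxBelow p := by
  classical
  have hq : q ∈ Finset.univ.filter fun r => r ⋖ p := by simpa using h
  unfold maxBelow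
  rw [dif_pos ⟨q, hq⟩]
  exact Finset.le_sup' _ hq

theorem maxBelow_le (π : PPartition P m) (p : P) : π.maxBelow p ≤ π.toFun p := by
  unfold maxBelow
  split_ifs with h
  · refine Finset.sup'_le _ _ fun r hr => π.monotone ?_
    simp only [Finset.mem_filter, Finset.mem_univ, true_and] at hr
    exact hr.le
  · exact Nat.zero_le _

open Classical in
/-- The piecewise-linear toggle at `p`. The natural number subtraction never truncates, since
`π p ≤ min {π r | p ⋖ r}`. -/
noncomputable def toggle (p : P) (π : PPartition P m) : PPartition P m where
  toFun q := if q = p then π.minAbove p + π.maxBelow p - π.toFun p else π.toFun q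
  monotone := by
    have := Fintype.toLocallyFiniteOrder (α := P)
    rw [monotone_iff_forall_covBy]
    intro a b hab
    have h1 := π.le_minAbove p
    have h2 := π.maxBelow_le p
    split_ifs with ha hb hb
    · exact le_rfl
    · subst ha
      have := π.minAbove_le hab
      omega
    · subst hb
      have := π.le_maxBelow hab
      omega
    · exact π.monotone hab.le
  le_height q := by
    have h1 := π.minAbove_le_height p
    have h2 := π.maxBelow_le p
    split_ifs with h
    · omega
    · exact π.le_height q

/-- `p₁, p₂, …, p_N` is a linear extension of `P`: every element of `P` is listed exactly once,
and no element is listed after a larger one. -/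
structure IsLinearExtension (l : List P) : Prop where
  nodup : l.Nodup
  mem : ∀ p, p ∈ l
  sorted : l.Pairwise fun p q => ¬ q < p

variable (P) in
theorem exists_isLinearExtension : ∃ l : List P, IsLinearExtension l := by
  classical
  let e : P ≃ LinearExtension P := Equiv.refl P
  let : Fintype (LinearExtension P) := Fintype.ofEquiv P e
  refine ⟨((Finset.univ : Finset (LinearExtension P)).sort (· ≤ ·)).map e.symm, ?_, ?_, ?_⟩
  · exact (Finset.sort_nodup _ _).map e.symm.injective
  · intro p
    simp only [List.mem_map, Finset.mem_sort, Finset.mem_univ, true_and]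
    exact ⟨e p, e.symm_apply_apply p⟩
  · rw [List.pairwise_map]
    refine (Finset.pairwise_sort (Finset.univ : Finset (LinearExtension P)) (· ≤ ·)).imp ?_
    intro a b hab hlt
    have h1 : b ≤ a := (toLinearExtension (α := P)).monotone hlt.le
    have h2 : a = b := le_antisymm hab h1
    subst h2
    exact lt_irrefl _ hlt

/-- The composition `τ_{p₁} · τ_{p₂} ⋯ τ_{p_N}` (the toggle at `p_N` is performed first). -/
noncomputable def toggleAlong (l : List P) (π : PPartition P m) : PPartition P m :=
  l.foldr toggle π

/-- Rowmotion: the composition `τ_{p₁} · τ_{p₂} ⋯ τ_{p_N}` for a linear extension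
`p₁, …, p_N` of `P`. By `rowmotion_eq_toggleAlong` the choice of linear extension is immaterial. -/
noncomputable def rowmotion : PPartition P m → PPartition P m :=
  toggleAlong (exists_isLinearExtension P).choose

theorem toggle_comm (p q : P) (h1 : ¬ p < q) (h2 : ¬ q < p) (π : PPartition P m) :
    toggle p (toggle q π) = toggle q (toggle p π) := by
  classical
  by_cases hpq : p = q
  · rw [hpq]
  have key : ∀ {a b : P}, ¬ a < b → ¬ b < a → a ≠ b →
      (toggle b π).minAbove a = π.minAbove a ∧ (toggle b π).maxBelow a = π.maxBelow a ∧
        (toggle b π).toFun a = π.toFun a := by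
    intro a b hab hba hne
    refine ⟨?_, ?_, ?_⟩
    · unfold minAbove
      split_ifs with h
      · refine Finset.inf'_congr _ rfl fun r hr => ?_
        simp only [Finset.mem_filter, Finset.mem_univ, true_and] at hr
        have : r ≠ b := by rintro rfl; exact hab hr.lt
        simp [toggle, this]
      · rfl
    · unfold maxBelow
      split_ifs with h
      · refine Finset.sup'_congr _ rfl fun r hr => ?_
        simp only [Finset.mem_filter, Finset.mem_univ, true_and] at hr
        have : r ≠ b := by rintro rfl; exact hba hr.lt
        simp [toggle, this]
      · rfl
    · simp [toggle, hne]
  obtain ⟨a1, a2, a3⟩ := key h1 h2 hpq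
  obtain ⟨b1, b2, b3⟩ := key h2 h1 (Ne.symm hpq)
  ext r
  change (if r = p then (toggle q π).minAbove p + (toggle q π).maxBelow p - (toggle q π).toFun p
      else (toggle q π).toFun r) =
    (if r = q then (toggle p π).minAbove q + (toggle p π).maxBelow q - (toggle p π).toFun q
      else (toggle p π).toFun r)
  rw [a1, a2, a3, b1, b2, b3]
  by_cases hrp : r = p
  · subst hrp
    simp [toggle, hpq]
  · by_cases hrq : r = q
    · subst hrq
      simp [toggle, hrp]
    · simp [toggle, hrp, hrq]

theorem toggleAlong_append_cons (s u : List P) (p : P)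
    (h : ∀ x ∈ s, ¬ x < p ∧ ¬ p < x) (π : PPartition P m) :
    toggleAlong (s ++ p :: u) π = toggle p (toggleAlong (s ++ u) π) := by
  induction s with
  | nil => rfl
  | cons x s ih =>
    have ih' := ih fun y hy => h y (List.mem_cons_of_mem _ hy)
    obtain ⟨hx1, hx2⟩ := h x List.mem_cons_self
    change toggle x (toggleAlong (s ++ p :: u) π) = toggle p (toggle x (toggleAlong (s ++ u) π))
    rw [ih', toggle_comm x p hx1 hx2]

theorem toggleAlong_eq_of_perm (l l' : List P) (hperm : l.Perm l')
    (hl : l.Pairwise fun p q => ¬ q < p) (hl' : l'.Pairwise fun p q => ¬ q < p)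
    (π : PPartition P m) : toggleAlong l π = toggleAlong l' π := by
  induction l generalizing l' with
  | nil => rw [List.nil_perm.mp hperm]
  | cons p t ih =>
    have hp : p ∈ l' := hperm.subset List.mem_cons_self
    obtain ⟨s, u, rfl⟩ := List.append_of_mem hp
    have hperm' : t.Perm (s ++ u) :=
      List.Perm.cons_inv (hperm.trans List.perm_middle)
    rw [List.pairwise_cons] at hl
    have hs : ∀ x ∈ s, ¬ x < p ∧ ¬ p < x := by
      intro x hx
      refine ⟨hl.1 x (hperm'.symm.subset (List.mem_append_left _ hx)), ?_⟩
      exact (List.pairwise_append.mp hl').2.2 x hx p List.mem_cons_self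
    rw [toggleAlong_append_cons s u p hs]
    have hsub : (s ++ u).Sublist (s ++ p :: u) :=
      (List.Sublist.refl s).append (List.sublist_cons_self p u)
    change toggle p (toggleAlong t π) = _
    rw [ih (s ++ u) hperm' hl.2 (hl'.sublist hsub)]

/-- Rowmotion does not depend on the choice of linear extension. -/
theorem rowmotion_eq_toggleAlong {l : List P} (hl : IsLinearExtension l) (π : PPartition P m) :
    rowmotion π = toggleAlong l π := by
  have hc := (exists_isLinearExtension P).choose_spec
  refine toggleAlong_eq_of_perm _ _ ?_ hc.sorted hl.sorted π
  rw [List.perm_ext_iff_of_nodup hc.nodup hl.nodup]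
  exact fun a => ⟨fun _ => hl.mem a, fun _ => hc.mem a⟩

end Poset

end PPartition

/-- The rectangle poset `a × b`: pairs `(i, j)` of row and column indices (numbered from `0`) with
the backwards order `(i, j) ≤ (i', j') ↔ i' ≤ i ∧ j' ≤ j`, so that `P`-partitions are arrays
that decrease weakly along rows and columns. -/
abbrev Rectangle (a b : ℕ) : Type := (Fin a)ᵒᵈ × (Fin b)ᵒᵈ

/-- The triangular poset `▽_k`, i.e. the positive root poset of type `A_k`: the upper-left triangle
`{(i, j) | i + j < k}` of the `k × k` rectangle (indices from `0`), with the induced order. It has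
a greatest element `(0, 0)` and the `k` minimal elements `(i, j)` with `i + j = k - 1`. -/
abbrev WideTriangle (k : ℕ) : Type :=
  {p : Rectangle k k // (OrderDual.ofDual p.1).val + (OrderDual.ofDual p.2).val < k}

/-- The transposition `Tr(π)_{i,j} = π_{j,i}` of an `n × n` plane partition. -/
def PPartition.transpose {n m : ℕ} (π : PPartition (Rectangle n n) m) :
    PPartition (Rectangle n n) m where
  toFun p := π.toFun p.swap
  monotone _ _ h := π.monotone (Prod.swap_le_swap.mpr h)
  le_height p := π.le_height p.swap

/-!
A `P`-partition `π` of the triangle is extended to a plane partition of the square (`wing`): add `M`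
above the antidiagonal `i + j = n + 1` (rows and columns numbered from `1`), put `M` on it, and in a
position below it, at distance `r`, put `M` minus the value of the `r`-th rowmotion iterate of `π`
at the mirror image. The toggle relations, which determine rowmotion (`PPartition.eq_rowmotion`),
show that `wing` commutes with rowmotion (`wing_rowmotion`).

That `wing` is onto the partitions fixed by `Tr ∘ Row ^ n` follows from reciprocity on the square
(`entry_iterate_rowmotion_add`): `Row ^ (i + j - 1) π` at `(n + 1 - i, n + 1 - j)` plus `π` at
`(i, j)` is the height `2 * M`. Applied to `wing π` it shows that `Row ^ n` is transposition on the
triangle, hence that `wing π` is fixed. For a fixed `σ` it shows that the antidiagonal has the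
constant value `M`, so that the part above it evolves by rowmotion of the triangle, and that the
part below is determined by the part above, exactly as in a wing.

Reciprocity is proved for birational rowmotion of positive real labelings, following the ideas of
Grinberg and Roby, and then tropicalized by letting the labels be `exp (s * π i j)` with `s → ∞`
(`GrowsLike.birRow`). A labeling `f` and its image `f'` under birational rowmotion are both sums
over lattice paths with the same weights `f v / ∑_{u ⋖ v} f u = (f' v)⁻¹ / ∑_{w ⋗ v} (f' w)⁻¹`:
`f v` is the sum over paths from `v` to the bottom, and `b / f' v` is the sum over paths from the
top to `v`. Hence reciprocity for the top row reduces to the fact that path sums between the top and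
the bottom row are the same for the up-weights of a labeling and, one column to the left, for its
down-weights (`IsLabeling.pathSum_upSlack_eq_downSlack`). Both are, up to the same factor, the
probability of a crossing event for two independent random walks, one going down and one going up,
evaluated at the first and at the last antidiagonal; and this probability does not depend on the
antidiagonal (`IsLabeling.crossing_succ`). The other rows follow one by one from the toggle
relations, which express the label of one neighbor of an element through the others
(`IsLabeling.reciprocity`).
-/

/-! ### Sums over lattice paths -/

/-- The sum, over all lattice paths from `(i, j)` to `(k, l)` with steps `(-1, 0)` and `(0, -1)`
that stay in positive coordinates, of the product of the weights `α` over all vertices of the path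
(both ends included). -/
noncomputable def pathSum (α : ℕ → ℕ → ℝ) (k l : ℕ) : ℕ → ℕ → ℝ
  | 0, _ => 0
  | _ + 1, 0 => 0
  | i + 1, j + 1 => α (i + 1) (j + 1) *
      ((if i + 1 = k ∧ j + 1 = l then 1 else 0) + pathSum α k l i (j + 1) + pathSum α k l (i + 1) j)
termination_by i j => i + j

section PathSum

variable (α : ℕ → ℕ → ℝ)

@[simp] theorem pathSum_zero_left (k l j : ℕ) : pathSum α k l 0 j = 0 := by
  simp [pathSum]

@[simp] theorem pathSum_zero_right (k l i : ℕ) : pathSum α k l i 0 = 0 := by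
  cases i <;> simp [pathSum]

theorem pathSum_succ_succ (k l i j : ℕ) :
    pathSum α k l (i + 1) (j + 1) = α (i + 1) (j + 1) *
      ((if i + 1 = k ∧ j + 1 = l then 1 else 0) + pathSum α k l i (j + 1)
        + pathSum α k l (i + 1) j) := by
  rw [pathSum]

theorem pathSum_eq_zero {k l : ℕ} : ∀ i j : ℕ, (i < k ∨ j < l) → pathSum α k l i j = 0
  | 0, _, _ => by simp
  | _ + 1, 0, _ => by simp
  | i + 1, j + 1, h => by
    rw [pathSum_succ_succ, pathSum_eq_zero i (j + 1) (by omega),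
      pathSum_eq_zero (i + 1) j (by omega), if_neg (by omega)]
    simp
termination_by i j => i + j

theorem pathSum_eq_zero_of_target {k l : ℕ} (h : k = 0 ∨ l = 0) :
    ∀ i j : ℕ, pathSum α k l i j = 0
  | 0, _ => by simp
  | _ + 1, 0 => by simp
  | i + 1, j + 1 => by
    rw [pathSum_succ_succ, pathSum_eq_zero_of_target h i (j + 1),
      pathSum_eq_zero_of_target h (i + 1) j, if_neg (by omega)]
    simp
termination_by i j => i + j

theorem pathSum_nonneg {n k l : ℕ} (hα : ∀ i j, 1 ≤ i → i ≤ n → 1 ≤ j → j ≤ n → 0 < α i j) :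
    ∀ i j : ℕ, i ≤ n → j ≤ n → 0 ≤ pathSum α k l i j
  | 0, _, _, _ => by simp
  | _ + 1, 0, _, _ => by simp
  | i + 1, j + 1, hi, hj => by
    have h1 := pathSum_nonneg (k := k) (l := l) hα i (j + 1) (by omega) hj
    have h2 := pathSum_nonneg (k := k) (l := l) hα (i + 1) j hi (by omega)
    have h3 := hα (i + 1) (j + 1) (by omega) hi (by omega) hj
    rw [pathSum_succ_succ]
    split_ifs <;> positivity
termination_by i j => i + j

theorem pathSum_pos {n k l : ℕ} (hα : ∀ i j, 1 ≤ i → i ≤ n → 1 ≤ j → j ≤ n → 0 < α i j)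
    (hk : 1 ≤ k) (hl : 1 ≤ l) :
    ∀ i j : ℕ, k ≤ i → l ≤ j → i ≤ n → j ≤ n → 0 < pathSum α k l i j
  | 0, _, h, _, _, _ => by omega
  | _ + 1, 0, _, h, _, _ => by omega
  | i + 1, j + 1, hki, hlj, hi, hj => by
    have h1 := pathSum_nonneg α (k := k) (l := l) hα i (j + 1) (by omega) hj
    have h2 := pathSum_nonneg α (k := k) (l := l) hα (i + 1) j hi (by omega)
    have h3 := hα (i + 1) (j + 1) (by omega) hi (by omega) hj
    rw [pathSum_succ_succ]
    apply mul_pos h3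
    by_cases hk' : k ≤ i
    · have := pathSum_pos hα hk hl i (j + 1) hk' hlj (by omega) hj
      split_ifs <;> positivity
    by_cases hl' : l ≤ j
    · have := pathSum_pos hα hk hl (i + 1) j hki hl' hi (by omega)
      split_ifs <;> positivity
    rw [if_pos (by omega)]
    positivity
termination_by i j => i + j

/-- Decomposition of path sums according to the last but one vertex; the definition decomposes
according to the second vertex. -/
theorem pathSum_eq_target {k l : ℕ} (hk : 1 ≤ k) (hl : 1 ≤ l) :
    ∀ i j : ℕ, pathSum α k l i j = α k l *
      ((if i = k ∧ j = l then 1 else 0) + pathSum α (k + 1) l i j + pathSum α k (l + 1) i j)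
  | 0, _ => by rw [if_neg (by omega)]; simp
  | _ + 1, 0 => by rw [if_neg (by omega)]; simp
  | i + 1, j + 1 => by
    rw [pathSum_succ_succ α k l i j, pathSum_succ_succ α (k + 1) l i j,
      pathSum_succ_succ α k (l + 1) i j, pathSum_eq_target hk hl i (j + 1),
      pathSum_eq_target hk hl (i + 1) j]
    have e1 : (i + 1 = k + 1 ∧ j + 1 = l) ↔ (i = k ∧ j + 1 = l) := by omega
    have e2 : (i + 1 = k ∧ j + 1 = l + 1) ↔ (i + 1 = k ∧ j = l) := by omega
    simp only [e1, e2]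
    by_cases h : i + 1 = k ∧ j + 1 = l
    · obtain ⟨rfl, rfl⟩ := h
      simp [pathSum_eq_zero]
    · simp only [h, if_false]
      ring
termination_by i j => i + j

end PathSum

/-! ### Birational rowmotion on a square -/

/-- `f` is positive on the square `{1, …, n} × {1, …, n}` and vanishes off it. As `0⁻¹ = 0`, both
the labels and their reciprocals contribute nothing off the square. -/
structure IsLabeling (n : ℕ) (f : ℕ → ℕ → ℝ) : Prop where
  pos : ∀ i j, 1 ≤ i → i ≤ n → 1 ≤ j → j ≤ n → 0 < f i j
  zero : ∀ i j, (i = 0 ∨ n < i ∨ j = 0 ∨ n < j) → f i j = 0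

/-- The sum of the labels of the elements covered by `(i, j)`; an extra element with label `1` is
placed below the bottom `(n, n)` of the square. -/
noncomputable def lowerSum (n : ℕ) (f : ℕ → ℕ → ℝ) (i j : ℕ) : ℝ :=
  (if i = n ∧ j = n then 1 else 0) + f (i + 1) j + f i (j + 1)

/-- The sum of the reciprocals of the labels of the elements covering `(i, j)`; an extra element
with label `b` is placed above the top `(1, 1)` of the square. -/
noncomputable def upperSum (b : ℝ) (f : ℕ → ℕ → ℝ) (i j : ℕ) : ℝ :=
  (if i = 1 ∧ j = 1 then b⁻¹ else 0) + (f (i - 1) j)⁻¹ + (f i (j - 1))⁻¹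

/-- The weights `f v / ∑_{u ⋖ v} f u`. -/
noncomputable def downSlack (n : ℕ) (f : ℕ → ℕ → ℝ) (i j : ℕ) : ℝ := f i j / lowerSum n f i j

/-- The weights `(f v)⁻¹ / ∑_{w ⋗ v} (f w)⁻¹`. -/
noncomputable def upSlack (b : ℝ) (f : ℕ → ℕ → ℝ) (i j : ℕ) : ℝ := (f i j)⁻¹ / upperSum b f i j

/-- Birational rowmotion on the labelings of the `n × n` square with the label `b` above the top
and `1` below the bottom, given by its path formula; `birRow_spec` is the usual description as a
composition of toggles. -/
noncomputable def birRow (n : ℕ) (b : ℝ) (f : ℕ → ℕ → ℝ) (i j : ℕ) : ℝ :=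
  b / pathSum (downSlack n f) 1 1 i j

section Birational

variable {n : ℕ} {b : ℝ} {f : ℕ → ℕ → ℝ}

theorem IsLabeling.nonneg (hf : IsLabeling n f) (i j : ℕ) : 0 ≤ f i j := by
  by_cases h : i = 0 ∨ n < i ∨ j = 0 ∨ n < j
  · rw [hf.zero i j h]
  · exact (hf.pos i j (by omega) (by omega) (by omega) (by omega)).le

theorem IsLabeling.lowerSum_pos (hf : IsLabeling n f) {i j : ℕ} (hi : 1 ≤ i) (hi' : i ≤ n)
    (hj : 1 ≤ j) (hj' : j ≤ n) : 0 < lowerSum n f i j := by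
  have h1 := hf.nonneg (i + 1) j
  have h2 := hf.nonneg i (j + 1)
  unfold lowerSum
  by_cases hin : i + 1 ≤ n
  · have := hf.pos (i + 1) j (by omega) hin hj hj'
    split_ifs <;> positivity
  by_cases hjn : j + 1 ≤ n
  · have := hf.pos i (j + 1) hi hi' (by omega) hjn
    split_ifs <;> positivity
  rw [if_pos (by omega)]
  positivity

theorem IsLabeling.upperSum_pos (hf : IsLabeling n f) (hb : 0 < b) {i j : ℕ} (hi : 1 ≤ i)
    (hi' : i ≤ n) (hj : 1 ≤ j) (hj' : j ≤ n) : 0 < upperSum b f i j := by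
  have h1 := hf.nonneg (i - 1) j
  have h2 := hf.nonneg i (j - 1)
  unfold upperSum
  by_cases hin : 2 ≤ i
  · have := hf.pos (i - 1) j (by omega) (by omega) hj hj'
    split_ifs <;> positivity
  by_cases hjn : 2 ≤ j
  · have := hf.pos i (j - 1) hi hi' (by omega) (by omega)
    split_ifs <;> positivity
  rw [if_pos (by omega)]
  positivity

theorem IsLabeling.downSlack_pos (hf : IsLabeling n f) (i j : ℕ) (hi : 1 ≤ i) (hi' : i ≤ n)
    (hj : 1 ≤ j) (hj' : j ≤ n) : 0 < downSlack n f i j :=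
  div_pos (hf.pos i j hi hi' hj hj') (hf.lowerSum_pos hi hi' hj hj')

theorem IsLabeling.map_birRow (hf : IsLabeling n f) (hb : 0 < b) : IsLabeling n (birRow n b f) where
  pos i j hi hi' hj hj' :=
    div_pos hb (pathSum_pos _ hf.downSlack_pos le_rfl le_rfl i j hi hj hi' hj')
  zero i j h := by
    unfold birRow
    match i, j with
    | 0, _ => simp
    | _ + 1, 0 => simp
    | i + 1, j + 1 =>
      rw [pathSum_succ_succ, downSlack, hf.zero _ _ h]
      simp

/-- Birational rowmotion turns down-slacks into up-slacks. -/
theorem IsLabeling.upSlack_birRow (hf : IsLabeling n f) (hb : 0 < b) {i j : ℕ} (hi : 1 ≤ i)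
    (hi' : i ≤ n) (hj : 1 ≤ j) (hj' : j ≤ n) :
    upSlack b (birRow n b f) i j = downSlack n f i j := by
  have hf' := hf.map_birRow hb
  have hU := hf'.upperSum_pos hb hi hi' hj hj'
  rw [upSlack, div_eq_iff hU.ne']
  obtain ⟨i, rfl⟩ := Nat.exists_eq_add_of_le' hi
  obtain ⟨j, rfl⟩ := Nat.exists_eq_add_of_le' hj
  simp only [birRow, upperSum, inv_div, Nat.add_sub_cancel]
  rw [pathSum_succ_succ]
  split_ifs
  · field_simp
  · field_simp
    ring

/-- The toggle description of birational rowmotion. -/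
theorem IsLabeling.birRow_spec (hf : IsLabeling n f) (hb : 0 < b) {i j : ℕ} (hi : 1 ≤ i)
    (hi' : i ≤ n) (hj : 1 ≤ j) (hj' : j ≤ n) :
    birRow n b f i j * f i j * upperSum b (birRow n b f) i j = lowerSum n f i j := by
  have h := hf.upSlack_birRow hb hi hi' hj hj'
  have hU := (hf.map_birRow hb).upperSum_pos hb hi hi' hj hj'
  have hD := hf.lowerSum_pos hi hi' hj hj'
  have h1 := (hf.map_birRow hb).pos i j hi hi' hj hj'
  rw [upSlack, downSlack, div_eq_div_iff hU.ne' hD.ne'] at h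
  field_simp at h
  rw [h]

/-- The path formula expressing a labeling through its down-slacks. -/
theorem IsLabeling.pathSum_downSlack (hf : IsLabeling n f) : ∀ i j : ℕ, 1 ≤ i → 1 ≤ j →
    pathSum (downSlack n f) i j n n = f i j := by
  suffices h : ∀ d i j : ℕ, 2 * n + 2 ≤ i + j + d → 1 ≤ i → 1 ≤ j →
      pathSum (downSlack n f) i j n n = f i j from
    fun i j hi hj => h (2 * n + 2) i j (by omega) hi hj
  intro d
  induction d with
  | zero =>
    intro i j h hi hj
    rw [hf.zero i j (by omega), pathSum_eq_zero _ n n (by omega)]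
  | succ d ih =>
    intro i j h hi hj
    by_cases hij : n < i ∨ n < j
    · rw [hf.zero i j (by omega), pathSum_eq_zero _ n n (by omega)]
    rw [pathSum_eq_target _ hi hj, ih (i + 1) j (by omega) (by omega) hj,
      ih i (j + 1) (by omega) hi (by omega), downSlack]
    have hD := hf.lowerSum_pos hi (by omega) hj (by omega)
    have e : lowerSum n f i j =
        (if n = i ∧ n = j then 1 else 0) + f (i + 1) j + f i (j + 1) := by
      simp only [lowerSum, eq_comm]
    rw [← e, div_mul_cancel₀ _ hD.ne']

theorem birRow_mul_pathSum (hf : IsLabeling n f) {i j : ℕ} (hi : 1 ≤ i)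
    (hi' : i ≤ n) (hj : 1 ≤ j) (hj' : j ≤ n) :
    birRow n b f i j * pathSum (downSlack n f) 1 1 i j = b :=
  div_mul_cancel₀ _
    (pathSum_pos _ hf.downSlack_pos le_rfl le_rfl i j hi hj hi' hj').ne'

end Birational

theorem pathSum_congr {n k l : ℕ} {α β : ℕ → ℕ → ℝ}
    (h : ∀ i j, 1 ≤ i → i ≤ n → 1 ≤ j → j ≤ n → α i j = β i j) :
    ∀ i j : ℕ, i ≤ n → j ≤ n → pathSum α k l i j = pathSum β k l i j
  | 0, _, _, _ => by simp
  | _ + 1, 0, _, _ => by simp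
  | i + 1, j + 1, hi, hj => by
    rw [pathSum_succ_succ, pathSum_succ_succ, pathSum_congr h i (j + 1) (by omega) hj,
      pathSum_congr h (i + 1) j hi (by omega), h _ _ (by omega) hi (by omega) hj]
termination_by i j => i + j

/-! ### Moving path sums by one column -/

section Conversion

open Finset

/-- The change of the crossing event between consecutive antidiagonals. The indices are columns: `G`
and `D` live on the upper of three consecutive antidiagonals, `f` and `e = f⁻¹` on the middle one,
`H` and `U` on the lower one. After both sides are written as sums over pairs `(x, y)` of the outer
antidiagonals, the only pairs whose contributions do not agree trivially have `y = x + 1`: there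
both intermediate elements lie between `x` and `y`, and `(f x + f (x + 1)) * e (x + 1)` equals
`f x * (e x + e (x + 1))`. -/
theorem crossing_step (N : ℕ) (f e G D H U : ℕ → ℝ) (hG : ∀ x, N ≤ x + 1 → G x = 0)
    (hf0 : f 0 = 0) (hH : ∀ y, N ≤ y → H y = 0)
    (hGD : ∀ x, G x * D x = G x * (f x + f (x + 1)))
    (hHU : ∀ y, H (y + 1) * U (y + 1) = H (y + 1) * (e (y + 1) + e y))
    (hfe : ∀ x, G x ≠ 0 → H (x + 1) ≠ 0 → f x * e x = f (x + 1) * e (x + 1)) :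
    ∑ x ∈ range N, ∑ z ∈ range N,
        (if x < z then G x * D x * (e z * (H z + H (z + 1))) else 0) =
      ∑ z ∈ range N, ∑ y ∈ range N,
        (if z < y then (f z * (G (z - 1) + G z)) * (H y * U y) else 0) := by
  have hL : ∀ x, ∑ z ∈ range N, (if x < z then G x * D x * (e z * (H z + H (z + 1))) else 0) =
      ∑ y ∈ range N, G x * D x * H y *
        ((if x < y then e y else 0) + if x + 1 < y then e (y - 1) else 0) := by
    intro x
    have h1 : ∑ z ∈ range N, (if x < z then G x * D x * (e z * H (z + 1)) else 0) =
        ∑ y ∈ range N, (if x + 1 < y then G x * D x * (e (y - 1) * H y) else 0) := by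
      have := (sum_range_succ
        (fun y => if x + 1 < y then G x * D x * (e (y - 1) * H y) else 0) N).symm.trans
        (sum_range_succ' _ N)
      simpa [hH N le_rfl] using this.symm
    calc _ = ∑ z ∈ range N, (if x < z then G x * D x * (e z * H z) else 0) +
          ∑ z ∈ range N, (if x < z then G x * D x * (e z * H (z + 1)) else 0) := by
          rw [← sum_add_distrib]
          refine sum_congr rfl fun z _ => ?_
          split_ifs <;> ring
      _ = _ := by
          rw [h1, ← sum_add_distrib]
          refine sum_congr rfl fun z _ => ?_
          split_ifs <;> ring
  have hR : ∀ y, ∑ z ∈ range N,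
      (if z < y then (f z * (G (z - 1) + G z)) * (H y * U y) else 0) =
      ∑ x ∈ range N, G x * (H y * U y) *
        ((if x < y then f x else 0) + if x + 1 < y then f (x + 1) else 0) := by
    intro y
    have h1 : ∑ z ∈ range N, (if z < y then (f z * G (z - 1)) * (H y * U y) else 0) =
        ∑ x ∈ range N, (if x + 1 < y then (f (x + 1) * G x) * (H y * U y) else 0) := by
      have := (sum_range_succ
        (fun z => if z < y then (f z * G (z - 1)) * (H y * U y) else 0) N).symm.trans
        (sum_range_succ' _ N)
      simpa [hf0, hG (N - 1) (by omega)] using this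
    calc _ = ∑ z ∈ range N, (if z < y then (f z * G z) * (H y * U y) else 0) +
          ∑ z ∈ range N, (if z < y then (f z * G (z - 1)) * (H y * U y) else 0) := by
          rw [← sum_add_distrib]
          refine sum_congr rfl fun z _ => ?_
          split_ifs <;> ring
      _ = _ := by
          rw [h1, ← sum_add_distrib]
          refine sum_congr rfl fun z _ => ?_
          split_ifs <;> ring
  rw [sum_congr rfl fun x _ => hL x, sum_comm (s := range N) (t := range N) (f := fun z y =>
    if z < y then (f z * (G (z - 1) + G z)) * (H y * U y) else 0),
    sum_congr rfl fun y _ => hR y, sum_comm]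
  refine sum_congr rfl fun y _ => sum_congr rfl fun x _ => ?_
  rw [hGD]
  obtain hyx | rfl | hxy : y ≤ x ∨ y = x + 1 ∨ x + 1 < y := by omega
  · rw [if_neg (by omega), if_neg (by omega), if_neg (by omega), if_neg (by omega)]
    simp
  · rw [hHU]
    simp only [Nat.lt_succ_self, if_true, lt_irrefl, if_false, add_zero]
    by_cases h1 : G x = 0
    · simp [h1]
    by_cases h2 : H (x + 1) = 0
    · simp [h2]
    linear_combination (- G x * H (x + 1)) * hfe x h1 h2
  · obtain ⟨y, rfl⟩ : ∃ y', y = y' + 1 := ⟨y - 1, by omega⟩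
    rw [hHU, if_pos (by omega), if_pos hxy, if_pos (by omega), if_pos hxy]
    simp only [Nat.add_sub_cancel]
    ring

end Conversion

section Conversion

open Finset

/-- Two random walks on the square, one from `(1, k)` downwards with steps of probability
proportional to `f`, the other from `(n, j + 1)` upwards with steps of probability proportional
to `f⁻¹`: up to a constant factor, this is the probability that the first, on reaching the
antidiagonal `s`, is strictly to the left of the second on the antidiagonal `s + 1`. -/
noncomputable def crossing (n : ℕ) (b : ℝ) (f : ℕ → ℕ → ℝ) (j k s : ℕ) : ℝ :=
  ∑ x ∈ range (n + 2), ∑ y ∈ range (n + 2), if x < y then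
    (pathSum (downSlack n f) 1 k (s - x) x * lowerSum n f (s - x) x) *
      (pathSum (upSlack b f) (s + 1 - y) y n (j + 1) * upperSum b f (s + 1 - y) y) else 0

variable {n : ℕ} {b : ℝ} {f : ℕ → ℕ → ℝ}

theorem IsLabeling.downSlack_mul_lowerSum (hf : IsLabeling n f) (i j : ℕ) :
    downSlack n f i j * lowerSum n f i j = f i j := by
  by_cases h : i = 0 ∨ n < i ∨ j = 0 ∨ n < j
  · simp [downSlack, hf.zero i j h]
  · exact div_mul_cancel₀ _ (hf.lowerSum_pos (by omega) (by omega) (by omega) (by omega)).ne'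

theorem IsLabeling.upSlack_mul_upperSum (hf : IsLabeling n f) (hb : 0 < b) (i j : ℕ) :
    upSlack b f i j * upperSum b f i j = (f i j)⁻¹ := by
  by_cases h : i = 0 ∨ n < i ∨ j = 0 ∨ n < j
  · simp [upSlack, hf.zero i j h]
  · exact div_mul_cancel₀ _ (hf.upperSum_pos hb (by omega) (by omega) (by omega) (by omega)).ne'

/-- The event that the two walks cross is the same on consecutive antidiagonals. -/
theorem IsLabeling.crossing_succ (hf : IsLabeling n f) (hb : 0 < b) {j k s : ℕ}
    (hj : j < n) (hk : 1 ≤ k) (hs : k + 1 ≤ s) (hs' : s < n + j) :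
    crossing n b f j k s = crossing n b f j k (s + 1) := by
  have key := crossing_step (n + 2) (fun c => f (s + 1 - c) c) (fun c => (f (s + 1 - c) c)⁻¹)
    (fun c => pathSum (downSlack n f) 1 k (s - c) c) (fun c => lowerSum n f (s - c) c)
    (fun c => pathSum (upSlack b f) (s + 2 - c) c n (j + 1))
    (fun c => upperSum b f (s + 2 - c) c) ?_ ?_ ?_ ?_ ?_ ?_
  · refine Eq.trans ?_ (key.trans ?_)
    · refine sum_congr rfl fun x hx => sum_congr rfl fun z hz => ?_
      split_ifs with hxz
      · congr 1
        by_cases hz' : s + 1 ≤ z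
        · rw [Nat.sub_eq_zero_of_le hz', pathSum_eq_zero_of_target _ (Or.inl rfl),
            hf.zero 0 z (Or.inl rfl)]
          simp
        · rw [pathSum_eq_target _ (by omega) (by omega), if_neg (by omega),
            ← hf.upSlack_mul_upperSum hb, show s + 2 - z = s + 1 - z + 1 by omega,
            show s + 2 - (z + 1) = s + 1 - z by omega]
          ring
      · rfl
    · refine sum_congr rfl fun z hz => sum_congr rfl fun y hy => ?_
      split_ifs with hxz
      · congr 1
        by_cases hz' : z = 0 ∨ s + 1 ≤ z
        · rw [hf.zero (s + 1 - z) z (by omega)]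
          obtain rfl | hz' := hz'
          · simp
          · simp [Nat.sub_eq_zero_of_le hz']
        · obtain ⟨z, rfl⟩ : ∃ z', z = z' + 1 := ⟨z - 1, by omega⟩
          rw [show s + 1 - (z + 1) = s - (z + 1) + 1 by omega, pathSum_succ_succ,
            if_neg (by omega), ← hf.downSlack_mul_lowerSum, Nat.add_sub_cancel,
            show s - z = s - (z + 1) + 1 by omega]
          ring
      · rfl
  · intro x hx
    by_cases hx' : s ≤ x
    · simp [Nat.sub_eq_zero_of_le hx']
    · obtain ⟨i, hi⟩ : ∃ i, s - x = i + 1 := ⟨s - x - 1, by omega⟩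
      obtain ⟨x, rfl⟩ : ∃ x', x = x' + 1 := ⟨x - 1, by omega⟩
      simp only [hi, pathSum_succ_succ, downSlack]
      rw [hf.zero _ _ (by omega)]
      simp
  · exact hf.zero _ _ (by omega)
  · intro y hy
    exact pathSum_eq_zero _ _ _ (by omega)
  · intro x
    by_cases hx' : s ≤ x
    · simp [Nat.sub_eq_zero_of_le hx']
    · simp only [lowerSum]
      rw [if_neg (by omega), zero_add, show s - x + 1 = s + 1 - x by omega,
        show s + 1 - (x + 1) = s - x by omega]
  · intro y
    by_cases hy : s + 2 ≤ y + 1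
    · simp only [Nat.sub_eq_zero_of_le hy, pathSum_eq_zero_of_target _ (Or.inl rfl), zero_mul]
    · simp only [upperSum]
      rw [if_neg (by omega), zero_add, show s + 2 - (y + 1) - 1 = s + 1 - (y + 1) by omega,
        show s + 2 - (y + 1) = s + 1 - y by omega, Nat.add_sub_cancel]
  · intro x hx hy
    have hx0 : x ≠ 0 := by rintro rfl; simp at hx
    have hxs : s - x ≠ 0 := by intro h; simp [h] at hx
    have hy1 : ¬ (n < s + 2 - (x + 1) ∨ j + 1 < x + 1) := by
      intro h
      exact hy (pathSum_eq_zero _ _ _ (by omega))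
    have h1 := hf.pos (s + 1 - x) x (by omega) (by omega) (by omega) (by omega)
    have h2 := hf.pos (s + 1 - (x + 1)) (x + 1) (by omega) (by omega) (by omega) (by omega)
    rw [mul_inv_cancel₀ h1.ne', mul_inv_cancel₀ h2.ne']

/-- On the last antidiagonal, crossing forces the first walk to be at `(n, j)`. -/
theorem IsLabeling.crossing_bottom (hf : IsLabeling n f) (hb : 0 < b) {j k : ℕ} (hj : j < n)
    (hj1 : 1 ≤ j) :
    crossing n b f j k (n + j) = pathSum (downSlack n f) 1 k n j := by
  have h0 : ∀ y ≤ n + j + 1, 1 ≤ y → y ≠ j + 1 →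
      pathSum (upSlack b f) (n + j + 1 - y) y n (j + 1) = 0 := fun y h1 h2 h3 =>
    pathSum_eq_zero _ _ _ (by omega)
  unfold crossing
  rw [sum_eq_single j, sum_eq_single (j + 1), if_pos (by omega)]
  · rw [show n + j + 1 - (j + 1) = n by omega, show n + j - j = n by omega,
      pathSum_eq_target (upSlack b f) (by omega) (by omega), if_pos (by omega),
      pathSum_eq_zero (upSlack b f) _ _ (by omega), pathSum_eq_zero (upSlack b f) _ _ (by omega),
      add_zero, add_zero, mul_one, hf.upSlack_mul_upperSum hb, lowerSum, if_neg (by omega),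
      hf.zero (n + 1) j (by omega), zero_add, zero_add,
      mul_assoc, mul_inv_cancel₀ (hf.pos n (j + 1) (by omega) le_rfl (by omega) (by omega)).ne',
      mul_one]
  · intro y hy hy'
    split_ifs with h
    · rw [h0 y (by simp at hy; omega) (by omega) hy']
      simp
    · rfl
  · intro h
    simp at h
    omega
  · intro x hx hx'
    refine sum_eq_zero fun y hy => ?_
    simp only [mem_range] at hx hy
    split_ifs with h
    · by_cases hyj : y = j + 1
      · subst hyj
        obtain ⟨i, hi⟩ : ∃ i, n + j - x = i + 1 := ⟨n + j - x - 1, by omega⟩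
        rw [hi]
        match x with
        | 0 => simp
        | x + 1 =>
          rw [pathSum_succ_succ, downSlack, hf.zero _ _ (by omega)]
          simp
      · rw [h0 y (by omega) (by omega) hyj]
        simp
    · rfl
  · intro h
    simp at h
    omega

/-- On the first antidiagonal, crossing forces the second walk to be at `(1, k + 1)`. -/
theorem IsLabeling.crossing_top (hf : IsLabeling n f) {j k : ℕ} (hk : 1 ≤ k)
    (hk' : k < n) :
    crossing n b f j k (k + 1) = pathSum (upSlack b f) 1 (k + 1) n (j + 1) := by
  have h0 : ∀ x < k + 1, x ≠ k → pathSum (downSlack n f) 1 k (k + 1 - x) x = 0 := fun x h1 h2 =>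
    pathSum_eq_zero _ _ _ (by omega)
  unfold crossing
  rw [sum_eq_single k, sum_eq_single (k + 1), if_pos (by omega)]
  · obtain ⟨k, rfl⟩ : ∃ k', k = k' + 1 := ⟨k - 1, by omega⟩
    rw [show k + 1 + 1 - (k + 1) = 0 + 1 by omega, pathSum_succ_succ, if_pos (by omega),
      pathSum_zero_left, pathSum_eq_zero _ _ _ (by omega), add_zero, add_zero, mul_one,
      hf.downSlack_mul_lowerSum, upperSum, if_neg (by omega)]
    have := hf.pos 1 (k + 1) le_rfl (by omega) (by omega) (by omega)
    rw [show k + 1 + 1 + 1 - (k + 1 + 1) = 1 by omega, Nat.sub_self, hf.zero 0 _ (by omega),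
      inv_zero, zero_add, zero_add, Nat.add_sub_cancel]
    field_simp
    simp
  · intro y hy hy'
    split_ifs with h
    · rw [show k + 1 + 1 - y = 0 by omega, pathSum_eq_zero_of_target _ (Or.inl rfl)]
      simp
    · rfl
  · intro h
    simp at h
    omega
  · intro x hx hx'
    refine sum_eq_zero fun y hy => ?_
    split_ifs with h
    · by_cases hxk : x < k + 1
      · rw [h0 x hxk hx']
        simp
      · rw [show k + 1 - x = 0 by omega]
        simp
    · rfl
  · intro h
    simp at h
    omega

/-- Path sums between the top and the bottom row are the same for up-slacks and for down-slacks,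
up to a shift by one column. -/
theorem IsLabeling.pathSum_upSlack_eq_downSlack (hf : IsLabeling n f) (hb : 0 < b) {j k : ℕ}
    (hk : 1 ≤ k) (hk' : k < n) (hj : 1 ≤ j) (hj' : j < n) :
    pathSum (upSlack b f) 1 (k + 1) n (j + 1) = pathSum (downSlack n f) 1 k n j := by
  by_cases hjk : j < k
  · rw [pathSum_eq_zero _ _ _ (by omega), pathSum_eq_zero _ _ _ (by omega)]
  rw [← hf.crossing_top hk hk', ← hf.crossing_bottom hb hj' hj]
  have h : ∀ d, k + 1 + d ≤ n + j →
      crossing n b f j k (k + 1) = crossing n b f j k (k + 1 + d) := by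
    intro d
    induction d with
    | zero => intro _; rfl
    | succ d ih =>
      intro hd
      rw [ih (by omega), hf.crossing_succ hb hj' hk (by omega) (by omega)]
      rfl
  rw [h (n + j - (k + 1)) (by omega), show k + 1 + (n + j - (k + 1)) = n + j by omega]

end Conversion

/-! ### Reciprocity for birational rowmotion -/

section Reciprocity

variable {n : ℕ} {b : ℝ} {f : ℕ → ℕ → ℝ}

theorem IsLabeling.iterate_birRow (hf : IsLabeling n f) (hb : 0 < b) (t : ℕ) :
    IsLabeling n ((birRow n b)^[t] f) := by
  induction t with
  | zero => exact hf
  | succ t ih =>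
    rw [Function.iterate_succ_apply']
    exact ih.map_birRow hb

/-- Down-slacks at one time are up-slacks at the next, so the shift by one column can be repeated. -/
theorem IsLabeling.pathSum_iterate (hf : IsLabeling n f) (hb : 0 < b) (d : ℕ) :
    ∀ (t k j : ℕ), 1 ≤ k → k + d ≤ n → 1 ≤ j → j + d ≤ n →
      pathSum (downSlack n ((birRow n b)^[t] f)) 1 (k + d) n (j + d) =
        pathSum (downSlack n ((birRow n b)^[t + d] f)) 1 k n j := by
  induction d with
  | zero => intros; rfl
  | succ d ih =>
    intro t k j hk hkd hj hjd
    have h1 := hf.iterate_birRow hb t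
    have h2 := hf.iterate_birRow hb (t + 1)
    have h3 := fun i j a b c d => (h1.upSlack_birRow hb (i := i) (j := j) a b c d).symm
    rw [pathSum_congr h3 n _ le_rfl hjd, ← Function.iterate_succ_apply' (birRow n b),
      ← add_assoc, ← add_assoc,
      h2.pathSum_upSlack_eq_downSlack hb (by omega) (by omega) (by omega) (by omega),
      ih (t + 1) k j hk (by omega) hj (by omega), add_right_comm]
    rfl

/-- Reciprocity for the elements of the top row. -/
theorem IsLabeling.reciprocity_edge (hf : IsLabeling n f) (hb : 0 < b) {j j' : ℕ} (hj : 1 ≤ j)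
    (hj' : 1 ≤ j') (h : j + j' = n + 1) (t : ℕ) :
    (birRow n b)^[t + j] f n j' * (birRow n b)^[t] f 1 j = b := by
  obtain ⟨j, rfl⟩ : ∃ i, j = i + 1 := ⟨j - 1, by omega⟩
  have h1 := hf.pathSum_iterate hb j t 1 j' le_rfl (by omega) hj' (by omega)
  rw [show j' + j = n by omega, add_comm 1 j,
    (hf.iterate_birRow hb t).pathSum_downSlack 1 (j + 1) le_rfl hj] at h1
  rw [h1, ← add_assoc, Function.iterate_succ_apply',
    birRow_mul_pathSum (hf.iterate_birRow hb _) (by omega) le_rfl hj' (by omega)]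

/-- Reciprocity for birational rowmotion on the square. It propagates from one row to the next
because the toggle relation at an element determines the label of one of its four neighbors from
the others. -/
theorem IsLabeling.reciprocity (hf : IsLabeling n f) (hb : 0 < b) :
    ∀ (i i' j j' t : ℕ), i + 1 + i' = n + 1 → 1 ≤ i' → j + j' = n + 1 → 1 ≤ j → 1 ≤ j' →
      (birRow n b)^[t + i + j] f i' j' * (birRow n b)^[t] f (i + 1) j = b := by
  intro i
  induction i using Nat.strong_induction_on with
  | _ i ih =>
  intro i' j j' t hi hi' hj hj1 hj1'
  obtain _ | i := i
  · obtain rfl : i' = n := by omega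
    exact hf.reciprocity_edge hb hj1 hj1' hj t
  have hF := fun s => hf.iterate_birRow hb s
  set F := fun s => (birRow n b)^[s] f
  have hF' : ∀ s, birRow n b (F s) = F (s + 1) := fun s =>
    (Function.iterate_succ_apply' _ _ _).symm
  change F (t + (i + 1) + j) i' j' * F t (i + 1 + 1) j = b
  change ∀ s, IsLabeling n (F s) at hF
  have ih' : ∀ i₁ < i + 1, ∀ (i₂ j₁ j₂ s : ℕ), i₁ + 1 + i₂ = n + 1 → 1 ≤ i₂ → j₁ + j₂ = n + 1 →
      1 ≤ j₁ → 1 ≤ j₂ → F (s + i₁ + j₁) i₂ j₂ = b * (F s (i₁ + 1) j₁)⁻¹ := by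
    intro i₁ h₁ i₂ j₁ j₂ s a1 a2 a3 a4 a5
    have := (hF s).pos (i₁ + 1) j₁ (by omega) (by omega) (by omega) (by omega)
    rw [eq_mul_inv_iff_mul_eq₀ this.ne']
    exact ih i₁ h₁ i₂ j₁ j₂ s a1 a2 a3 a4 a5
  -- The toggle relations at `(i + 1, j)` and at the opposite element `(i' + 1, j')`.
  have e1 := (hF t).birRow_spec hb (i := i + 1) (j := j) (by omega) (by omega) (by omega) (by omega)
  have e2 := (hF (t + i + j)).birRow_spec hb (i := i' + 1) (j := j') (by omega) (by omega)
    (by omega) (by omega)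
  rw [hF'] at e1 e2
  have a1 := ih' i (by omega) (i' + 1) j j' t (by omega) (by omega) hj hj1 hj1'
  have a2 := ih' i (by omega) (i' + 1) j j' (t + 1) (by omega) (by omega) hj hj1 hj1'
  have a3 : lowerSum n (F (t + i + j)) (i' + 1) j' = b * upperSum b (F (t + 1)) (i + 1) j := by
    have b1 : F (t + i + j) (i' + 1 + 1) j' = b * (F (t + 1) (i + 1 - 1) j)⁻¹ := by
      obtain _ | i := i
      · rw [(hF _).zero _ _ (by omega), (hF _).zero _ _ (by omega)]
        simp
      · rw [Nat.add_sub_cancel,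
          ← ih' i (by omega) (i' + 1 + 1) j j' (t + 1) (by omega) (by omega) hj hj1 hj1']
        congr 1
        omega
    have b2 : F (t + i + j) (i' + 1) (j' + 1) = b * (F (t + 1) (i + 1) (j - 1))⁻¹ := by
      obtain rfl | hj2 := hj1.eq_or_lt
      · rw [(hF _).zero _ _ (by omega), (hF _).zero _ _ (by omega)]
        simp
      · rw [← ih' i (by omega) (i' + 1) (j - 1) (j' + 1) (t + 1) (by omega) (by omega) (by omega)
          (by omega) (by omega)]
        congr 1
        omega
    have e : (i' + 1 = n ∧ j' = n) ↔ (i + 1 = 1 ∧ j = 1) := by omega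
    rw [lowerSum, upperSum, b1, b2]
    simp only [e]
    split_ifs
    · field_simp
    · ring
  have a4 : b * upperSum b (F (t + i + j + 1)) (i' + 1) j' =
      b * (F (t + i + j + 1) i' j')⁻¹ + F t (i + 1) (j + 1) := by
    have b1 : b * (F (t + i + j + 1) (i' + 1) (j' - 1))⁻¹ = F t (i + 1) (j + 1) := by
      obtain rfl | hj2 := hj1'.eq_or_lt
      · rw [(hF _).zero _ _ (by omega), (hF _).zero _ _ (by omega)]
        simp
      · rw [add_assoc, ih' i (by omega) (i' + 1) (j + 1) (j' - 1) t (by omega) (by omega)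
          (by omega) (by omega) (by omega)]
        field_simp
    rw [upperSum, if_neg (by omega), zero_add, mul_add, b1, Nat.add_sub_cancel]
  have a5 : lowerSum n (F t) (i + 1) j = F t (i + 1 + 1) j + F t (i + 1) (j + 1) := by
    rw [lowerSum, if_neg (by omega), zero_add]
  have p1 := (hF t).pos (i + 1) j (by omega) (by omega) (by omega) (by omega)
  have p2 := (hF (t + 1)).pos (i + 1) j (by omega) (by omega) (by omega) (by omega)
  have p3 := (hF (t + i + j + 1)).pos i' j' (by omega) (by omega) (by omega) (by omega)
  have a6 : F (t + i + j + 1) (i' + 1) j' = b * (F (t + 1) (i + 1) j)⁻¹ := by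
    rw [← a2]
    congr 1
    omega
  rw [a1, a3, a6] at e2
  rw [a5] at e1
  have e3 : b * upperSum b (F (t + i + j + 1)) (i' + 1) j' =
      F t (i + 1 + 1) j + F t (i + 1) (j + 1) := by
    rw [← e1]
    field_simp at e2 ⊢
    linear_combination e2
  rw [a4] at e3
  rw [show t + (i + 1) + j = t + i + j + 1 by omega, ← add_right_cancel e3]
  field_simp

end Reciprocity

/-! ### Rowmotion through toggle relations -/

namespace PPartition

section Poset

variable {P : Type*} [PartialOrder P] [Fintype P] {m : ℕ}

theorem le_minAbove_iff (π : PPartition P m) (p : P) (d : ℕ) :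
    d ≤ π.minAbove p ↔ d ≤ m ∧ ∀ r, p ⋖ r → d ≤ π.toFun r := by
  classical
  refine ⟨fun h => ⟨h.trans (π.minAbove_le_height p), fun r hr => h.trans (π.minAbove_le hr)⟩,
    fun ⟨h1, h2⟩ => ?_⟩
  unfold minAbove
  split_ifs with h
  · exact Finset.le_inf' _ _ fun r hr => h2 r (by simpa using hr)
  · exact h1

theorem maxBelow_le_iff (π : PPartition P m) (p : P) (d : ℕ) :
    π.maxBelow p ≤ d ↔ ∀ r, r ⋖ p → π.toFun r ≤ d := by
  classical
  refine ⟨fun h r hr => (π.le_maxBelow hr).trans h, fun h2 => ?_⟩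
  unfold maxBelow
  split_ifs with h
  · exact Finset.sup'_le _ _ fun r hr => h2 r (by simpa using hr)
  · exact Nat.zero_le _

theorem minAbove_congr {π σ : PPartition P m} {p : P} (h : ∀ r, p ⋖ r → π.toFun r = σ.toFun r) :
    π.minAbove p = σ.minAbove p := by
  refine eq_of_forall_le_iff fun d => ?_
  rw [le_minAbove_iff, le_minAbove_iff]
  refine and_congr_right fun _ => forall₂_congr fun r hr => ?_
  rw [h r hr]

theorem maxBelow_congr {π σ : PPartition P m} {p : P} (h : ∀ r, r ⋖ p → π.toFun r = σ.toFun r) :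
    π.maxBelow p = σ.maxBelow p := by
  refine eq_of_forall_ge_iff fun d => ?_
  rw [maxBelow_le_iff, maxBelow_le_iff]
  refine forall₂_congr fun r hr => ?_
  rw [h r hr]

theorem toggle_toFun_self (π : PPartition P m) (p : P) :
    (toggle p π).toFun p = π.minAbove p + π.maxBelow p - π.toFun p := by
  simp [toggle]

theorem toggle_toFun_of_ne (π : PPartition P m) {p q : P} (h : q ≠ p) :
    (toggle p π).toFun q = π.toFun q := by
  simp [toggle, h]

open Classical in
/-- The value at `p` after toggling along a linear extension of an upper set. -/
theorem toggleAlong_toFun (π : PPartition P m) (l : List P) (hn : l.Nodup)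
    (hs : l.Pairwise fun p q => ¬ q < p) (hu : ∀ p ∈ l, ∀ q, p < q → q ∈ l) (p : P) :
    (toggleAlong l π).toFun p = if p ∈ l then
      (toggleAlong l π).minAbove p + π.maxBelow p - π.toFun p else π.toFun p := by
  induction l generalizing p with
  | nil => simp [toggleAlong]
  | cons a t ih =>
    rw [List.nodup_cons] at hn
    rw [List.pairwise_cons] at hs
    have ih := ih hn.2 hs.2 fun p hp q hpq => by
      have := hu p (List.mem_cons_of_mem _ hp) q hpq
      rw [List.mem_cons] at this
      refine this.resolve_left ?_
      rintro rfl
      exact hs.1 p hp hpq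
    change (toggle a (toggleAlong t π)).toFun p =
      if p ∈ a :: t then (toggle a (toggleAlong t π)).minAbove p + _ - _ else _
    by_cases hpa : p = a
    · subst hpa
      have h1 : (toggleAlong t π).toFun p = π.toFun p := by rw [ih, if_neg hn.1]
      have h2 : (toggleAlong t π).maxBelow p = π.maxBelow p := maxBelow_congr fun r hr => by
        rw [ih, if_neg fun h => hs.1 r h hr.lt]
      have h3 : (toggle p (toggleAlong t π)).minAbove p = (toggleAlong t π).minAbove p :=
        minAbove_congr fun r hr => toggle_toFun_of_ne _ hr.ne'
      rw [toggle_toFun_self, if_pos List.mem_cons_self, h1, h2, h3]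
    · rw [toggle_toFun_of_ne _ hpa, ih]
      by_cases hpt : p ∈ t
      · rw [if_pos hpt, if_pos (List.mem_cons_of_mem _ hpt)]
        have h3 : (toggle a (toggleAlong t π)).minAbove p = (toggleAlong t π).minAbove p :=
          minAbove_congr fun r hr => toggle_toFun_of_ne _ fun h => hs.1 p hpt (h ▸ hr.lt)
        rw [h3]
      · rw [if_neg hpt, if_neg (by simp [hpa, hpt])]

theorem rowmotion_toFun (π : PPartition P m) (p : P) :
    (rowmotion π).toFun p = (rowmotion π).minAbove p + π.maxBelow p - π.toFun p := by
  have h := (exists_isLinearExtension P).choose_spec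
  have := toggleAlong_toFun π _ h.nodup h.sorted (fun _ _ q _ => h.mem q) p
  rwa [if_pos (h.mem p)] at this

/-- The values of `π` lie below those of `rowmotion π` one step higher up. -/
theorem le_minAbove_rowmotion (π : PPartition P m) (p : P) :
    π.toFun p ≤ (rowmotion π).minAbove p := by
  induction p using WellFoundedGT.induction with
  | _ p ih =>
  rw [le_minAbove_iff]
  refine ⟨π.le_height p, fun r hr => ?_⟩
  have h1 := ih r hr.lt
  have h2 := rowmotion_toFun π r
  have h3 := π.le_maxBelow hr
  omega

/-- The toggle relations for rowmotion, in a form without subtraction. -/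
theorem rowmotion_add (π : PPartition P m) (p : P) :
    (rowmotion π).toFun p + π.toFun p = (rowmotion π).minAbove p + π.maxBelow p := by
  have h1 := rowmotion_toFun π p
  have h2 := le_minAbove_rowmotion π p
  omega

theorem maxBelow_le_rowmotion (π : PPartition P m) (p : P) :
    π.maxBelow p ≤ (rowmotion π).toFun p := by
  have h1 := rowmotion_toFun π p
  have h2 := le_minAbove_rowmotion π p
  omega

/-- The toggle relations determine rowmotion. -/
theorem eq_rowmotion (π σ : PPartition P m)
    (h : ∀ p, σ.toFun p + π.toFun p = σ.minAbove p + π.maxBelow p) : σ = rowmotion π := by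
  have key : ∀ p, σ.toFun p = (rowmotion π).toFun p := by
    intro p
    induction p using WellFoundedGT.induction with
    | _ p ih =>
    have h1 := h p
    have h2 := rowmotion_add π p
    have h3 : σ.minAbove p = (rowmotion π).minAbove p := minAbove_congr fun r hr => ih r hr.lt
    omega
  ext p
  exact key p

end Poset

end PPartition

/-! ### Posets with planar coordinates -/

/-- Coordinates identifying a poset with a finite set of pairs of positive integers which contains,
with `(i, j)`, all `(i', j')` where `1 ≤ i' ≤ i` and `1 ≤ j' ≤ j`, with the backwards
componentwise order. -/
structure ShapeCoords (P : Type*) [PartialOrder P] where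
  row : P → ℕ
  col : P → ℕ
  one_le_row : ∀ p, 1 ≤ row p
  one_le_col : ∀ p, 1 ≤ col p
  le_iff : ∀ p q, p ≤ q ↔ row q ≤ row p ∧ col q ≤ col p
  exists_of_le : ∀ p i j, 1 ≤ i → i ≤ row p → 1 ≤ j → j ≤ col p → ∃ q, row q = i ∧ col q = j

namespace ShapeCoords

variable {P : Type*} [PartialOrder P] (c : ShapeCoords P) {m : ℕ}

theorem ext_iff {p q : P} : p = q ↔ c.row p = c.row q ∧ c.col p = c.col q := by
  rw [le_antisymm_iff, c.le_iff, c.le_iff]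
  omega

theorem covBy_iff {p q : P} : p ⋖ q ↔
    (c.row p = c.row q + 1 ∧ c.col p = c.col q) ∨ (c.row p = c.row q ∧ c.col p = c.col q + 1) := by
  have hlt : ∀ p q : P, p < q ↔ (c.row q ≤ c.row p ∧ c.col q ≤ c.col p) ∧
      ¬ (c.row p ≤ c.row q ∧ c.col p ≤ c.col q) := fun p q => by
    rw [lt_iff_le_not_ge, c.le_iff, c.le_iff]
  constructor
  · intro h
    have h1 := (hlt p q).1 h.lt
    have hq1 := c.one_le_row q
    have hq2 := c.one_le_col q
    by_contra hne
    by_cases hr : c.row q < c.row p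
    · obtain ⟨r, hr1, hr2⟩ := c.exists_of_le p (c.row p - 1) (c.col p) (by omega) (by omega)
        (by omega) le_rfl
      refine h.2 (c := r) ((hlt _ _).2 ?_) ((hlt _ _).2 ?_) <;> omega
    · obtain ⟨r, hr1, hr2⟩ := c.exists_of_le p (c.row p) (c.col p - 1) (by omega) le_rfl
        (by omega) (by omega)
      refine h.2 (c := r) ((hlt _ _).2 ?_) ((hlt _ _).2 ?_) <;> omega
  · intro h
    refine ⟨(hlt p q).2 (by omega), fun r h1 h2 => ?_⟩
    rw [hlt] at h1 h2
    omega

open Classical in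
/-- The entry of a `P`-partition in position `(i, j)`; the positions with `i = 0` or `j = 0` carry
the entry `m`, all other positions outside the shape carry the entry `0`. -/
noncomputable def entry (π : PPartition P m) (i j : ℕ) : ℕ :=
  if i = 0 ∨ j = 0 then m
  else if h : ∃ p, c.row p = i ∧ c.col p = j then π.toFun h.choose else 0

variable {c}

theorem entry_coords (π : PPartition P m) (p : P) :
    c.entry π (c.row p) (c.col p) = π.toFun p := by
  have h1 := c.one_le_row p
  have h2 := c.one_le_col p
  have h : ∃ q, c.row q = c.row p ∧ c.col q = c.col p := ⟨p, rfl, rfl⟩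
  rw [entry, if_neg (by omega), dif_pos h, c.ext_iff.2 h.choose_spec]

theorem entry_of_coords (π : PPartition P m) {p : P} {i j : ℕ} (hi : c.row p = i)
    (hj : c.col p = j) : c.entry π i j = π.toFun p := by
  rw [← hi, ← hj, entry_coords]

theorem entry_of_eq_zero (π : PPartition P m) {i j : ℕ} (h : i = 0 ∨ j = 0) :
    c.entry π i j = m := if_pos h

theorem entry_of_not_exists (π : PPartition P m) {i j : ℕ} (hi : 1 ≤ i) (hj : 1 ≤ j)
    (h : ¬ ∃ p, c.row p = i ∧ c.col p = j) : c.entry π i j = 0 := by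
  rw [entry, if_neg (by omega), dif_neg h]

theorem entry_le (π : PPartition P m) (i j : ℕ) : c.entry π i j ≤ m := by
  unfold entry
  split_ifs
  · exact le_rfl
  · exact π.le_height _
  · exact Nat.zero_le _

theorem entry_anti (π : PPartition P m) {i j i' j' : ℕ} (hi : i ≤ i') (hj : j ≤ j') :
    c.entry π i' j' ≤ c.entry π i j := by
  by_cases h0 : i = 0 ∨ j = 0
  · rw [entry_of_eq_zero π h0]
    exact entry_le π _ _
  by_cases h : ∃ p, c.row p = i' ∧ c.col p = j'
  · obtain ⟨p, rfl, rfl⟩ := h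
    obtain ⟨q, rfl, rfl⟩ := c.exists_of_le p i j (by omega) hi (by omega) hj
    rw [entry_coords, entry_coords]
    exact π.monotone ((c.le_iff p q).2 ⟨hi, hj⟩)
  · rw [entry_of_not_exists π (by omega) (by omega) h]
    exact Nat.zero_le _

variable [Fintype P]

theorem minAbove_eq (π : PPartition P m) (p : P) :
    π.minAbove p =
      min (c.entry π (c.row p - 1) (c.col p)) (c.entry π (c.row p) (c.col p - 1)) := by
  have h1 := c.one_le_row p
  have h2 := c.one_le_col p
  refine eq_of_forall_le_iff fun d => ?_
  rw [PPartition.le_minAbove_iff, le_min_iff]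
  constructor
  · rintro ⟨hd, h⟩
    constructor
    · by_cases h0 : c.row p = 1
      · rwa [entry_of_eq_zero π (by omega)]
      · obtain ⟨q, hq1, hq2⟩ := c.exists_of_le p (c.row p - 1) (c.col p) (by omega) (by omega)
          (by omega) le_rfl
        rw [entry_of_coords π hq1 hq2]
        exact h q (c.covBy_iff.2 (by omega))
    · by_cases h0 : c.col p = 1
      · rwa [entry_of_eq_zero π (by omega)]
      · obtain ⟨q, hq1, hq2⟩ := c.exists_of_le p (c.row p) (c.col p - 1) (by omega) le_rfl
          (by omega) (by omega)
        rw [entry_of_coords π hq1 hq2]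
        exact h q (c.covBy_iff.2 (by omega))
  · rintro ⟨ha, hb⟩
    refine ⟨ha.trans (entry_le π _ _), fun r hr => ?_⟩
    rw [← entry_coords (c := c) π r]
    obtain h | h := c.covBy_iff.1 hr
    · rwa [h.1, h.2, Nat.add_sub_cancel] at ha
    · rwa [h.1, h.2, Nat.add_sub_cancel] at hb

theorem maxBelow_eq (π : PPartition P m) (p : P) :
    π.maxBelow p =
      max (c.entry π (c.row p + 1) (c.col p)) (c.entry π (c.row p) (c.col p + 1)) := by
  have h1 := c.one_le_row p
  have h2 := c.one_le_col p
  refine eq_of_forall_ge_iff fun d => ?_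
  rw [PPartition.maxBelow_le_iff, max_le_iff]
  constructor
  · intro h
    constructor
    · by_cases h0 : ∃ q, c.row q = c.row p + 1 ∧ c.col q = c.col p
      · obtain ⟨q, hq1, hq2⟩ := h0
        rw [entry_of_coords π hq1 hq2]
        exact h q (c.covBy_iff.2 (by omega))
      · rw [entry_of_not_exists π (by omega) (by omega) h0]
        exact Nat.zero_le _
    · by_cases h0 : ∃ q, c.row q = c.row p ∧ c.col q = c.col p + 1
      · obtain ⟨q, hq1, hq2⟩ := h0
        rw [entry_of_coords π hq1 hq2]
        exact h q (c.covBy_iff.2 (by omega))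
      · rw [entry_of_not_exists π (by omega) (by omega) h0]
        exact Nat.zero_le _
  · rintro ⟨ha, hb⟩ r hr
    rw [← entry_coords (c := c) π r]
    obtain h | h := c.covBy_iff.1 hr
    · rwa [h.1, h.2]
    · rwa [h.1, h.2]

variable (c) in
/-- The toggle relations for rowmotion in coordinates. -/
theorem entry_rowmotion (π : PPartition P m) (p : P) :
    c.entry π.rowmotion (c.row p) (c.col p) + c.entry π (c.row p) (c.col p) =
      min (c.entry π.rowmotion (c.row p - 1) (c.col p))
          (c.entry π.rowmotion (c.row p) (c.col p - 1)) +
        max (c.entry π (c.row p + 1) (c.col p)) (c.entry π (c.row p) (c.col p + 1)) := by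
  rw [← minAbove_eq, ← maxBelow_eq, entry_coords, entry_coords, PPartition.rowmotion_add]

end ShapeCoords

/-- Coordinates `1, …, n` on the square. -/
def squareCoords (n : ℕ) : ShapeCoords (Rectangle n n) where
  row p := (OrderDual.ofDual p.1).val + 1
  col p := (OrderDual.ofDual p.2).val + 1
  one_le_row _ := Nat.le_add_left _ _
  one_le_col _ := Nat.le_add_left _ _
  le_iff p q := by
    rw [Prod.le_def, ← OrderDual.ofDual_le_ofDual, ← OrderDual.ofDual_le_ofDual, Fin.le_def,
      Fin.le_def]
    omega
  exists_of_le p i j hi hi' hj hj' := by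
    have h1 := (OrderDual.ofDual p.1).isLt
    have h2 := (OrderDual.ofDual p.2).isLt
    refine ⟨(OrderDual.toDual ⟨i - 1, by omega⟩, OrderDual.toDual ⟨j - 1, by omega⟩), ?_, ?_⟩
    · exact Nat.sub_add_cancel hi
    · exact Nat.sub_add_cancel hj

/-- Coordinates on the triangle, identifying it with `{(i, j) | 1 ≤ i, 1 ≤ j, i + j ≤ k + 1}`. -/
def triangleCoords (k : ℕ) : ShapeCoords (WideTriangle k) where
  row p := (squareCoords k).row p.1
  col p := (squareCoords k).col p.1
  one_le_row _ := Nat.le_add_left _ _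
  one_le_col _ := Nat.le_add_left _ _
  le_iff p q := (squareCoords k).le_iff p.1 q.1
  exists_of_le p i j hi hi' hj hj' := by
    obtain ⟨q, hq1, hq2⟩ := (squareCoords k).exists_of_le p.1 i j hi hi' hj hj'
    have h := p.2
    refine ⟨⟨q, ?_⟩, hq1, hq2⟩
    simp only [squareCoords] at *
    omega

theorem squareCoords_row_le {n : ℕ} (p : Rectangle n n) : (squareCoords n).row p ≤ n :=
  (OrderDual.ofDual p.1).isLt

theorem squareCoords_col_le {n : ℕ} (p : Rectangle n n) : (squareCoords n).col p ≤ n :=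
  (OrderDual.ofDual p.2).isLt

theorem exists_squareCoords {n i j : ℕ} (hi : 1 ≤ i) (hi' : i ≤ n) (hj : 1 ≤ j) (hj' : j ≤ n) :
    ∃ p, (squareCoords n).row p = i ∧ (squareCoords n).col p = j :=
  ⟨(OrderDual.toDual ⟨i - 1, by omega⟩, OrderDual.toDual ⟨j - 1, by omega⟩),
    Nat.sub_add_cancel hi, Nat.sub_add_cancel hj⟩

theorem triangleCoords_add_le {k : ℕ} (p : WideTriangle k) :
    (triangleCoords k).row p + (triangleCoords k).col p ≤ k + 1 := by
  have := p.2
  simp only [triangleCoords, squareCoords]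
  omega

theorem exists_triangleCoords {k i j : ℕ} (hi : 1 ≤ i) (hj : 1 ≤ j) (h : i + j ≤ k + 1) :
    ∃ p, (triangleCoords k).row p = i ∧ (triangleCoords k).col p = j := by
  obtain ⟨p, h1, h2⟩ := exists_squareCoords (n := k) hi (by omega) hj (by omega)
  refine ⟨⟨p, ?_⟩, h1, h2⟩
  simp only [squareCoords] at h1 h2
  omega

/-! ### Tropicalization -/

open Filter Topology in
/-- The function `x` is positive and grows like `exp (a * s)`, up to subexponential factors. -/
structure GrowsLike (x : ℝ → ℝ) (a : ℝ) : Prop where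
  pos : ∀ s, 0 < x s
  tendsto : Tendsto (fun s => Real.log (x s) / s) atTop (𝓝 a)

namespace GrowsLike

open Filter Topology

variable {x y : ℝ → ℝ} {a b : ℝ}

theorem exp (a : ℝ) : GrowsLike (fun s => Real.exp (s * a)) a where
  pos s := Real.exp_pos _
  tendsto := by
    refine tendsto_const_nhds.congr' ?_
    filter_upwards [eventually_gt_atTop 0] with s hs
    rw [Real.log_exp, mul_div_cancel_left₀ _ hs.ne']

theorem one : GrowsLike (fun _ => 1) 0 := by
  simpa using GrowsLike.exp 0

theorem mul (hx : GrowsLike x a) (hy : GrowsLike y b) : GrowsLike (fun s => x s * y s) (a + b) where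
  pos s := mul_pos (hx.pos s) (hy.pos s)
  tendsto := by
    refine (hx.tendsto.add hy.tendsto).congr fun s => ?_
    rw [Real.log_mul (hx.pos s).ne' (hy.pos s).ne', add_div]

theorem inv (hx : GrowsLike x a) : GrowsLike (fun s => (x s)⁻¹) (-a) where
  pos s := inv_pos.2 (hx.pos s)
  tendsto := by
    refine hx.tendsto.neg.congr fun s => ?_
    rw [Real.log_inv, neg_div]

/-- Sums of positive functions become maxima of growth rates. -/
theorem add (hx : GrowsLike x a) (hy : GrowsLike y b) :
    GrowsLike (fun s => x s + y s) (max a b) where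
  pos s := add_pos (hx.pos s) (hy.pos s)
  tendsto := by
    have h1 := hx.tendsto.max hy.tendsto
    have h2 : Tendsto (fun s : ℝ => Real.log 2 / s) atTop (𝓝 0) :=
      tendsto_const_nhds.div_atTop tendsto_id
    have h3 := h1.add h2
    rw [add_zero] at h3
    refine tendsto_of_tendsto_of_tendsto_of_le_of_le' h1 h3 ?_ ?_
    · filter_upwards [eventually_gt_atTop 0] with s hs
      have px := hx.pos s
      have py := hy.pos s
      refine max_le ?_ ?_ <;> gcongr <;> linarith
    · filter_upwards [eventually_gt_atTop 0] with s hs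
      have px := hx.pos s
      have py := hy.pos s
      rw [max_div_div_right hs.le, ← add_div]
      gcongr
      have key : ∀ u v : ℝ, 0 < u → 0 < v → u ≤ v →
          Real.log (u + v) ≤ Real.log v + Real.log 2 := fun u v hu hv h => by
        rw [← Real.log_mul hv.ne' two_ne_zero]
        exact Real.log_le_log (by positivity) (by linarith)
      obtain h | h := le_total (x s) (y s)
      · exact (key _ _ px py h).trans (by gcongr; exact le_max_right _ _)
      · rw [add_comm (x s)]
        exact (key _ _ py px h).trans (by gcongr; exact le_max_left _ _)

theorem unique (hx : GrowsLike x a) (hx' : GrowsLike x b) : a = b :=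
  tendsto_nhds_unique hx.tendsto hx'.tendsto

end GrowsLike

section Tropicalization

variable {n m : ℕ}

local notation "E" => ShapeCoords.entry (squareCoords n)

theorem entry_square_of_lt (π : PPartition (Rectangle n n) m) {i j : ℕ} (hi : 1 ≤ i) (hj : 1 ≤ j)
    (h : n < i ∨ n < j) : E π i j = 0 := by
  refine ShapeCoords.entry_of_not_exists π hi hj ?_
  rintro ⟨p, rfl, rfl⟩
  have := squareCoords_row_le p
  have := squareCoords_col_le p
  omega

theorem GrowsLike.lowerSum {x : ℝ → ℕ → ℕ → ℝ} {π : PPartition (Rectangle n n) m}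
    (hx : ∀ s, IsLabeling n (x s)) {i j : ℕ} (hi : 1 ≤ i) (hi' : i ≤ n) (hj : 1 ≤ j) (hj' : j ≤ n)
    (h1 : i < n → GrowsLike (fun s => x s (i + 1) j) (E π (i + 1) j))
    (h2 : j < n → GrowsLike (fun s => x s i (j + 1)) (E π i (j + 1))) :
    GrowsLike (fun s => lowerSum n (x s) i j) (max (E π (i + 1) j : ℝ) (E π i (j + 1))) := by
  unfold _root_.lowerSum
  obtain hin | hin := hi'.lt_or_eq <;> obtain hjn | hjn := hj'.lt_or_eq
  · simpa [hin.ne] using (h1 hin).add (h2 hjn)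
  · rw [entry_square_of_lt π (i := i) (j := j + 1) hi (by omega) (by omega)]
    have e : ∀ s, x s i (j + 1) = 0 := fun s => (hx s).zero _ _ (by omega)
    simpa [hin.ne, e] using h1 hin
  · rw [entry_square_of_lt π (i := i + 1) (j := j) (by omega) hj (by omega)]
    have e : ∀ s, x s (i + 1) j = 0 := fun s => (hx s).zero _ _ (by omega)
    simpa [hjn.ne, e] using h2 hjn
  · rw [entry_square_of_lt π (i := i + 1) (j := j) (by omega) hj (by omega),
      entry_square_of_lt π (i := i) (j := j + 1) hi (by omega) (by omega)]
    have e : ∀ s, x s (i + 1) j = 0 := fun s => (hx s).zero _ _ (by omega)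
    have e' : ∀ s, x s i (j + 1) = 0 := fun s => (hx s).zero _ _ (by omega)
    simp only [e, e']
    simpa [hin, hjn] using GrowsLike.one

theorem GrowsLike.upperSum {x : ℝ → ℕ → ℕ → ℝ} {π : PPartition (Rectangle n n) m}
    (hx : ∀ s, IsLabeling n (x s)) {i j : ℕ} (hi : 1 ≤ i) (hj : 1 ≤ j)
    (h1 : 1 < i → GrowsLike (fun s => x s (i - 1) j) (E π (i - 1) j))
    (h2 : 1 < j → GrowsLike (fun s => x s i (j - 1)) (E π i (j - 1))) :
    GrowsLike (fun s => upperSum (Real.exp (s * m)) (x s) i j)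
      (-min (E π (i - 1) j : ℝ) (E π i (j - 1))) := by
  unfold _root_.upperSum
  have hle : ∀ i j, (E π i j : ℝ) ≤ m := fun i j => by
    exact_mod_cast ShapeCoords.entry_le π i j
  rw [← max_neg_neg]
  obtain hin | rfl := hi.lt_or_eq <;> obtain hjn | rfl := hj.lt_or_eq
  · simpa [hin.ne'] using (h1 hin).inv.add (h2 hjn).inv
  · rw [ShapeCoords.entry_of_eq_zero π (i := i) (j := 1 - 1) (Or.inr rfl),
      max_eq_left (neg_le_neg (hle _ _))]
    have e : ∀ s, x s i 0 = 0 := fun s => (hx s).zero _ _ (by omega)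
    simpa [hin.ne', e] using (h1 hin).inv
  · rw [ShapeCoords.entry_of_eq_zero π (i := 1 - 1) (j := j) (Or.inl rfl),
      max_eq_right (neg_le_neg (hle _ _))]
    have e : ∀ s, x s 0 j = 0 := fun s => (hx s).zero _ _ (by omega)
    simpa [hjn.ne', e] using (h2 hjn).inv
  · rw [ShapeCoords.entry_of_eq_zero π (i := 1 - 1) (j := 1) (Or.inl rfl),
      ShapeCoords.entry_of_eq_zero π (i := 1) (j := 1 - 1) (Or.inr rfl), max_self]
    have e : ∀ s, x s 0 1 = 0 := fun s => (hx s).zero _ _ (by omega)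
    have e' : ∀ s, x s 1 0 = 0 := fun s => (hx s).zero _ _ (by omega)
    simpa [e, e'] using (GrowsLike.exp (m : ℝ)).inv

/-- Rowmotion of `P`-partitions is the tropicalization of birational rowmotion. -/
theorem GrowsLike.birRow {x : ℝ → ℕ → ℕ → ℝ} {π : PPartition (Rectangle n n) m}
    (hx : ∀ s, IsLabeling n (x s))
    (h : ∀ i j, 1 ≤ i → i ≤ n → 1 ≤ j → j ≤ n → GrowsLike (fun s => x s i j) (E π i j)) :
    ∀ i j, 1 ≤ i → i ≤ n → 1 ≤ j → j ≤ n →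
      GrowsLike (fun s => birRow n (Real.exp (s * m)) (x s) i j) (E π.rowmotion i j) := by
  intro i j
  induction hd : i + j using Nat.strong_induction_on generalizing i j with
  | _ d ih =>
  intro hi hi' hj hj'
  have hb : ∀ s : ℝ, 0 < Real.exp (s * m) := fun s => Real.exp_pos _
  have hx' : ∀ s, IsLabeling n (_root_.birRow n (Real.exp (s * m)) (x s)) := fun s =>
    (hx s).map_birRow (hb s)
  have hU := GrowsLike.upperSum (π := π.rowmotion) hx' hi hj
    (fun h => ih _ (by omega) (i - 1) j rfl (by omega) (by omega) hj hj')
    (fun h => ih _ (by omega) i (j - 1) rfl hi hi' (by omega) (by omega))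
  have hD := GrowsLike.lowerSum (π := π) hx hi hi' hj hj'
    (fun h' => h _ _ (by omega) (by omega) hj hj') (fun h' => h _ _ hi hi' (by omega) (by omega))
  have hp := (hD.mul hU.inv).mul (h i j hi hi' hj hj').inv
  have key : (E π.rowmotion i j : ℝ) =
      max (E π (i + 1) j : ℝ) (E π i (j + 1)) +
        - -min (E π.rowmotion (i - 1) j : ℝ) (E π.rowmotion i (j - 1)) + -(E π i j : ℝ) := by
    obtain ⟨p, rfl, rfl⟩ := exists_squareCoords hi hi' hj hj'
    have := (squareCoords n).entry_rowmotion π p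
    rify at this
    linarith
  rw [key]
  convert hp using 2 with s
  have h1 := (hx s).birRow_spec (hb s) hi hi' hj hj'
  have h2 := hU.pos s
  have h3 := (hx s).pos i j hi hi' hj hj'
  rw [← h1]
  field_simp

/-- Reciprocity for rowmotion of plane partitions in an `n × n × m` box. -/
theorem entry_iterate_rowmotion_add (π : PPartition (Rectangle n n) m) {i i' j j' : ℕ}
    (hi : i + 1 + i' = n + 1) (hi' : 1 ≤ i') (hj : j + j' = n + 1) (hj1 : 1 ≤ j) (hj1' : 1 ≤ j') :
    E (PPartition.rowmotion^[i + j] π) i' j' + E π (i + 1) j = m := by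
  set x : ℝ → ℕ → ℕ → ℝ := fun s i j =>
    if 1 ≤ i ∧ i ≤ n ∧ 1 ≤ j ∧ j ≤ n then Real.exp (s * E π i j) else 0 with hxdef
  have hx : ∀ s, IsLabeling n (x s) := fun s =>
    ⟨fun i j h1 h2 h3 h4 => by simp only [hxdef]; rw [if_pos ⟨h1, h2, h3, h4⟩]; positivity,
      fun i j h => if_neg (by omega)⟩
  have hb : ∀ s : ℝ, 0 < Real.exp (s * m) := fun s => Real.exp_pos _
  have hgrow : ∀ t i j, 1 ≤ i → i ≤ n → 1 ≤ j → j ≤ n →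
      GrowsLike (fun s => (birRow n (Real.exp (s * m)))^[t] (x s) i j)
        (E (PPartition.rowmotion^[t] π) i j) := by
    intro t
    induction t with
    | zero =>
      intro i j h1 h2 h3 h4
      simpa [hxdef, h1, h2, h3, h4] using GrowsLike.exp (E π i j : ℝ)
    | succ t ih =>
      intro i j h1 h2 h3 h4
      simp only [Function.iterate_succ_apply']
      exact GrowsLike.birRow (fun s => (hx s).iterate_birRow (hb s) t) ih i j h1 h2 h3 h4
  have h1 := (hgrow (i + j) i' j' (by omega) (by omega) (by omega) (by omega)).mul
    (hgrow 0 (i + 1) j (by omega) (by omega) (by omega) (by omega))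
  have h2 : ∀ s, _ = _ := fun s => (hx s).reciprocity (hb s) i i' j j' 0 hi hi' hj hj1 hj1'
  simp only [zero_add] at h2
  simp only [h2] at h1
  exact_mod_cast h1.unique (GrowsLike.exp (m : ℝ))

end Tropicalization

/-! ### From the triangle to the square -/

section Wing

variable {n M : ℕ}

local notation "E" => ShapeCoords.entry (squareCoords n)
local notation "T" => ShapeCoords.entry (triangleCoords (n - 1))

theorem entry_triangle_of_lt (π : PPartition (WideTriangle (n - 1)) M) {i j : ℕ} (hi : 1 ≤ i)
    (hj : 1 ≤ j) (h : n < i + j) : T π i j = 0 := by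
  refine ShapeCoords.entry_of_not_exists π hi hj ?_
  rintro ⟨p, rfl, rfl⟩
  have := triangleCoords_add_le p
  omega

theorem entry_rowmotion_triangle (π : PPartition (WideTriangle (n - 1)) M) {i j : ℕ} (hi : 1 ≤ i)
    (hj : 1 ≤ j) (h : i + j ≤ n) :
    T π.rowmotion i j + T π i j = min (T π.rowmotion (i - 1) j) (T π.rowmotion i (j - 1)) +
      max (T π (i + 1) j) (T π i (j + 1)) := by
  obtain ⟨p, rfl, rfl⟩ := exists_triangleCoords (k := n - 1) hi hj (by omega)
  exact (triangleCoords (n - 1)).entry_rowmotion π p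

theorem entry_succ_le_rowmotion_triangle (π : PPartition (WideTriangle (n - 1)) M) {i j : ℕ}
    (hi : 1 ≤ i) (hj : 1 ≤ j) :
    T π (i + 1) j ≤ T π.rowmotion i j ∧ T π i (j + 1) ≤ T π.rowmotion i j := by
  by_cases h : i + j ≤ n
  · obtain ⟨p, rfl, rfl⟩ := exists_triangleCoords (k := n - 1) hi hj (by omega)
    have := PPartition.maxBelow_le_rowmotion π p
    rw [ShapeCoords.maxBelow_eq (c := triangleCoords (n - 1)), max_le_iff,
      ← ShapeCoords.entry_coords (c := triangleCoords (n - 1))] at this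
    exact this
  · rw [entry_triangle_of_lt π (by omega) hj (by omega),
      entry_triangle_of_lt π hi (by omega) (by omega)]
    simp

variable (n) in
/-- The entries of the plane partition obtained from a `P`-partition `π` of the triangle: `M + π`
above the antidiagonal `i + j = n + 1`, `M` on it, and below it, at distance `r`, the complement
of the reflection of the `r`-th rowmotion iterate of `π`. The subtraction never truncates, as the
entries of a `P`-partition of height `M` are at most `M`. -/
noncomputable def wingEntry (π : PPartition (WideTriangle (n - 1)) M) (i j : ℕ) : ℕ :=
  if i + j ≤ n + 1 then M + T π i j
  else M - T (PPartition.rowmotion^[i + j - (n + 1)] π) (n + 1 - j) (n + 1 - i)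

theorem wingEntry_of_le (π : PPartition (WideTriangle (n - 1)) M) {i j : ℕ} (h : i + j ≤ n + 1) :
    wingEntry n π i j = M + T π i j := if_pos h

/-- Both cases of the definition agree on the antidiagonal. -/
theorem wingEntry_of_ge (π : PPartition (WideTriangle (n - 1)) M) {i j r : ℕ} (hi : 1 ≤ i)
    (hi' : i ≤ n) (hj : 1 ≤ j) (h : i + j = n + 1 + r) :
    wingEntry n π i j = M - T (PPartition.rowmotion^[r] π) (n + 1 - j) (n + 1 - i) := by
  unfold wingEntry
  split_ifs with hle
  · obtain rfl : r = 0 := by omega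
    rw [entry_triangle_of_lt π hi hj (by omega), entry_triangle_of_lt _ (by omega) (by omega)
      (by omega)]
    rfl
  · rw [h, Nat.add_sub_cancel_left]

theorem wingEntry_succ_row_le (π : PPartition (WideTriangle (n - 1)) M) {i j : ℕ} (hi : 1 ≤ i)
    (hj : 1 ≤ j) (hj' : j ≤ n) (hi' : i < n) :
    wingEntry n π (i + 1) j ≤ wingEntry n π i j := by
  by_cases h : i + j ≤ n
  · rw [wingEntry_of_le π (by omega), wingEntry_of_le π (by omega)]
    exact Nat.add_le_add_left (ShapeCoords.entry_anti π (by omega) le_rfl) M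
  · obtain ⟨r, hr⟩ : ∃ r, i + j = n + 1 + r := ⟨i + j - (n + 1), by omega⟩
    rw [wingEntry_of_ge π (r := r) hi (by omega) hj hr,
      wingEntry_of_ge π (r := r + 1) (by omega) (by omega) hj (by omega)]
    refine Nat.sub_le_sub_left ?_ M
    rw [Function.iterate_succ_apply', show n + 1 - i = n + 1 - (i + 1) + 1 by omega]
    exact (entry_succ_le_rowmotion_triangle _ (by omega) (by omega)).2

theorem wingEntry_succ_col_le (π : PPartition (WideTriangle (n - 1)) M) {i j : ℕ} (hi : 1 ≤ i)
    (hj : 1 ≤ j) (hj' : j < n) (hi' : i ≤ n) :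
    wingEntry n π i (j + 1) ≤ wingEntry n π i j := by
  by_cases h : i + j ≤ n
  · rw [wingEntry_of_le π (by omega), wingEntry_of_le π (by omega)]
    exact Nat.add_le_add_left (ShapeCoords.entry_anti π le_rfl (by omega)) M
  · obtain ⟨r, hr⟩ : ∃ r, i + j = n + 1 + r := ⟨i + j - (n + 1), by omega⟩
    rw [wingEntry_of_ge π (r := r) hi (by omega) hj hr,
      wingEntry_of_ge π (r := r + 1) (by omega) (by omega) (by omega) (by omega)]
    refine Nat.sub_le_sub_left ?_ M
    rw [Function.iterate_succ_apply', show n + 1 - j = n + 1 - (j + 1) + 1 by omega]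
    exact (entry_succ_le_rowmotion_triangle _ (by omega) (by omega)).1

variable (n) in
/-- The plane partition with entries `wingEntry`. -/
noncomputable def wing (π : PPartition (WideTriangle (n - 1)) M) :
    PPartition (Rectangle n n) (2 * M) where
  toFun p := wingEntry n π ((squareCoords n).row p) ((squareCoords n).col p)
  monotone := by
    classical
    have := Fintype.toLocallyFiniteOrder (α := Rectangle n n)
    rw [monotone_iff_forall_covBy]
    intro p q hpq
    have h1 := squareCoords_row_le p
    have h2 := squareCoords_col_le p
    have h3 := (squareCoords n).one_le_row q
    have h4 := (squareCoords n).one_le_col q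
    obtain h | h := (squareCoords n).covBy_iff.1 hpq
    · rw [h.1] at h1 ⊢
      rw [h.2] at h2 ⊢
      exact wingEntry_succ_row_le π h3 h4 h2 h1
    · rw [h.1] at h1 ⊢
      rw [h.2] at h2 ⊢
      exact wingEntry_succ_col_le π h3 h4 h2 h1
  le_height p := by
    have := ShapeCoords.entry_le (c := triangleCoords (n - 1)) π ((squareCoords n).row p)
      ((squareCoords n).col p)
    unfold wingEntry
    split_ifs <;> omega

theorem entry_wing (π : PPartition (WideTriangle (n - 1)) M) {i j : ℕ} (hi : i ≤ n + 1)
    (hj : j ≤ n + 1) :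
    E (wing n π) i j = wingEntry n π i j := by
  by_cases h0 : i = 0 ∨ j = 0
  · rw [ShapeCoords.entry_of_eq_zero _ h0, wingEntry_of_le π (by omega),
      ShapeCoords.entry_of_eq_zero _ h0, two_mul]
  by_cases h1 : n < i ∨ n < j
  · rw [entry_square_of_lt _ (by omega) (by omega) h1, wingEntry]
    split_ifs
    · omega
    · rw [ShapeCoords.entry_of_eq_zero _ (by omega), Nat.sub_self]
  · obtain ⟨p, rfl, rfl⟩ := exists_squareCoords (n := n) (i := i) (j := j) (by omega) (by omega)
      (by omega) (by omega)
    rw [ShapeCoords.entry_coords]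
    rfl

/-- The toggle relations for rowmotion hold for the entries of the wing. -/
theorem wingEntry_rowmotion (π : PPartition (WideTriangle (n - 1)) M) {i j : ℕ} (hi : 1 ≤ i)
    (hi' : i ≤ n) (hj : 1 ≤ j) (hj' : j ≤ n) :
    wingEntry n π.rowmotion i j + wingEntry n π i j =
      min (wingEntry n π.rowmotion (i - 1) j) (wingEntry n π.rowmotion i (j - 1)) +
        max (wingEntry n π (i + 1) j) (wingEntry n π i (j + 1)) := by
  obtain h | h | h : i + j ≤ n ∨ i + j = n + 1 ∨ n + 1 < i + j := by omega
  · rw [wingEntry_of_le _ (by omega), wingEntry_of_le _ (by omega), wingEntry_of_le _ (by omega),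
      wingEntry_of_le _ (by omega), wingEntry_of_le _ (by omega), wingEntry_of_le _ (by omega)]
    have := entry_rowmotion_triangle π hi hj h
    omega
  -- On the antidiagonal, the entries below are complementary to the new entries above.
  · have e1 : wingEntry n π (i + 1) j = M - T π.rowmotion i (j - 1) := by
      rw [wingEntry, if_neg (by omega), show i + 1 + j - (n + 1) = 1 by omega,
        show n + 1 - j = i by omega, show n + 1 - (i + 1) = j - 1 by omega]
      rfl
    have e2 : wingEntry n π i (j + 1) = M - T π.rowmotion (i - 1) j := by
      rw [wingEntry, if_neg (by omega), show i + (j + 1) - (n + 1) = 1 by omega,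
        show n + 1 - (j + 1) = i - 1 by omega, show n + 1 - i = j by omega]
      rfl
    rw [e1, e2, wingEntry_of_le _ (by omega), wingEntry_of_le _ (by omega),
      wingEntry_of_le _ (by omega), wingEntry_of_le _ (by omega),
      entry_triangle_of_lt _ hi hj (by omega), entry_triangle_of_lt _ hi hj (by omega)]
    have h1 := ShapeCoords.entry_le (c := triangleCoords (n - 1)) π.rowmotion i (j - 1)
    have h2 := ShapeCoords.entry_le (c := triangleCoords (n - 1)) π.rowmotion (i - 1) j
    omega
  · obtain ⟨r, hr⟩ : ∃ r, i + j = n + 1 + (r + 1) := ⟨i + j - (n + 1) - 1, by omega⟩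
    have e1 : wingEntry n π (i + 1) j =
        M - T (PPartition.rowmotion^[r + 2] π) (n + 1 - j) (n + 1 - i - 1) := by
      rw [wingEntry, if_neg (by omega), show i + 1 + j - (n + 1) = r + 2 by omega,
        show n + 1 - (i + 1) = n + 1 - i - 1 by omega]
    have e2 : wingEntry n π i (j + 1) =
        M - T (PPartition.rowmotion^[r + 2] π) (n + 1 - j - 1) (n + 1 - i) := by
      rw [wingEntry, if_neg (by omega), show i + (j + 1) - (n + 1) = r + 2 by omega,
        show n + 1 - (j + 1) = n + 1 - j - 1 by omega]
    rw [e1, e2, wingEntry_of_ge π (r := r + 1) hi hi' hj hr,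
      wingEntry_of_ge π.rowmotion (r := r + 1) hi hi' hj hr,
      wingEntry_of_ge π.rowmotion (r := r) (by omega) (by omega) hj (by omega),
      wingEntry_of_ge π.rowmotion (r := r) hi hi' (by omega) (by omega)]
    simp only [← Function.iterate_succ_apply]
    have key := entry_rowmotion_triangle (n := n) (PPartition.rowmotion^[r + 1] π)
      (i := n + 1 - j) (j := n + 1 - i) (by omega) (by omega) (by omega)
    rw [← Function.iterate_succ_apply' PPartition.rowmotion] at key
    rw [show n + 1 - (i - 1) = n + 1 - i + 1 by omega,
      show n + 1 - (j - 1) = n + 1 - j + 1 by omega]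
    have hle : ∀ t i j, T (PPartition.rowmotion^[t] π) i j ≤ M := fun t i j =>
      ShapeCoords.entry_le _ i j
    have h1 := hle (r + 1) (n + 1 - j) (n + 1 - i)
    have h2 := hle (r + 2) (n + 1 - j) (n + 1 - i)
    have h3 := hle (r + 1) (n + 1 - j + 1) (n + 1 - i)
    have h4 := hle (r + 1) (n + 1 - j) (n + 1 - i + 1)
    have h5 := hle (r + 2) (n + 1 - j - 1) (n + 1 - i)
    have h6 := hle (r + 2) (n + 1 - j) (n + 1 - i - 1)
    simp only [Nat.succ_eq_add_one, add_assoc, Nat.reduceAdd] at *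
    omega

theorem wing_rowmotion (π : PPartition (WideTriangle (n - 1)) M) :
    wing n π.rowmotion = (wing n π).rowmotion := by
  refine PPartition.eq_rowmotion _ _ fun p => ?_
  have h1 := squareCoords_row_le p
  have h2 := squareCoords_col_le p
  have h3 := (squareCoords n).one_le_row p
  have h4 := (squareCoords n).one_le_col p
  rw [ShapeCoords.minAbove_eq (c := squareCoords n), ShapeCoords.maxBelow_eq (c := squareCoords n),
    entry_wing _ (by omega) (by omega),
    entry_wing _ (by omega) (by omega),
    entry_wing _ (by omega) (by omega),
    entry_wing _ (by omega) (by omega)]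
  exact wingEntry_rowmotion π h3 h1 h4 h2

theorem wing_iterate_rowmotion (π : PPartition (WideTriangle (n - 1)) M) (t : ℕ) :
    wing n (PPartition.rowmotion^[t] π) = PPartition.rowmotion^[t] (wing n π) :=
  (Function.Semiconj.iterate_right (wing_rowmotion (n := n) (M := M)) t) π

/-- The `n`-th iterate of rowmotion on the triangle is transposition. -/
theorem entry_iterate_rowmotion_triangle (π : PPartition (WideTriangle (n - 1)) M) {i j : ℕ}
    (hi : 1 ≤ i) (hj : 1 ≤ j) :
    T (PPartition.rowmotion^[n] π) j i = T π i j := by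
  by_cases h : i + j ≤ n
  · obtain ⟨i, rfl⟩ := Nat.exists_eq_add_of_le' hi
    have key := entry_iterate_rowmotion_add (wing n π) (i := i) (i' := n - i) (j := j)
      (j' := n + 1 - j) (by omega) (by omega) (by omega) (by omega) (by omega)
    rw [← wing_iterate_rowmotion,
      entry_wing _ (by omega) (by omega),
      entry_wing _ (by omega) (by omega),
      wingEntry_of_ge _ (i := n - i) (r := n - i - j) (by omega) (by omega) (by omega)
        (by omega), wingEntry_of_le _ (by omega), ← Function.iterate_add_apply,
      show n - i - j + (i + j) = n by omega, show n + 1 - (n + 1 - j) = j by omega,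
      show n + 1 - (n - i) = i + 1 by omega] at key
    have h1 := ShapeCoords.entry_le (c := triangleCoords (n - 1)) (PPartition.rowmotion^[n] π) j
      (i + 1)
    omega
  · rw [entry_triangle_of_lt _ hj hi (by omega), entry_triangle_of_lt _ hi hj (by omega)]

/-- A `P`-partition is determined by its entries. -/
theorem ShapeCoords.ppartition_ext {P : Type*} [PartialOrder P] (c : ShapeCoords P) {m : ℕ}
    {π σ : PPartition P m}
    (h : ∀ p, c.entry π (c.row p) (c.col p) = c.entry σ (c.row p) (c.col p)) : π = σ := by
  ext p
  have := h p
  rwa [entry_coords, entry_coords] at this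

theorem entry_transpose {m : ℕ} (π : PPartition (Rectangle n n) m) {i j : ℕ} (hi : 1 ≤ i)
    (hi' : i ≤ n) (hj : 1 ≤ j) (hj' : j ≤ n) : E π.transpose i j = E π j i := by
  obtain ⟨p, rfl, rfl⟩ := exists_squareCoords hi hi' hj hj'
  rw [ShapeCoords.entry_coords]
  exact (ShapeCoords.entry_of_coords (c := squareCoords n) π (p := p.swap) rfl rfl).symm

/-- The wing of every `P`-partition of the triangle satisfies the symmetry condition. -/
theorem transpose_iterate_rowmotion_wing (π : PPartition (WideTriangle (n - 1)) M) :
    (PPartition.rowmotion^[n] (wing n π)).transpose = wing n π := by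
  refine (squareCoords n).ppartition_ext fun p => ?_
  have h1 := squareCoords_row_le p
  have h2 := squareCoords_col_le p
  have h3 := (squareCoords n).one_le_row p
  have h4 := (squareCoords n).one_le_col p
  rw [entry_transpose _ h3 h1 h4 h2, ← wing_iterate_rowmotion,
    entry_wing _ (by omega) (by omega),
    entry_wing _ (by omega) (by omega), wingEntry, wingEntry]
  generalize (squareCoords n).row p = i at *
  generalize (squareCoords n).col p = j at *
  rw [add_comm j i]
  split_ifs with h
  · rw [entry_iterate_rowmotion_triangle π h3 h4]
  · rw [← Function.iterate_add_apply, add_comm, Function.iterate_add_apply,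
      entry_iterate_rowmotion_triangle _ (by omega) (by omega)]

end Wing

/-! ### From the square to the triangle -/

section Restriction

variable {n M : ℕ}

local notation "E" => ShapeCoords.entry (squareCoords n)
local notation "T" => ShapeCoords.entry (triangleCoords (n - 1))

theorem transpose_rowmotion {m : ℕ} (π : PPartition (Rectangle n n) m) :
    π.rowmotion.transpose = π.transpose.rowmotion := by
  refine PPartition.eq_rowmotion _ _ fun p => ?_
  have hrow : (squareCoords n).row p.swap = (squareCoords n).col p := rfl
  have hcol : (squareCoords n).col p.swap = (squareCoords n).row p := rfl
  have hE : ∀ (σ : PPartition (Rectangle n n) m) (i j : ℕ), E σ.transpose i j = E σ j i := by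
    intro σ i j
    by_cases h0 : i = 0 ∨ j = 0
    · rw [ShapeCoords.entry_of_eq_zero _ h0, ShapeCoords.entry_of_eq_zero _ h0.symm]
    by_cases h1 : n < i ∨ n < j
    · rw [entry_square_of_lt _ (by omega) (by omega) h1,
        entry_square_of_lt _ (by omega) (by omega) h1.symm]
    · exact entry_transpose σ (by omega) (by omega) (by omega) (by omega)
  have key := PPartition.rowmotion_add π p.swap
  rw [ShapeCoords.minAbove_eq (c := squareCoords n), ShapeCoords.maxBelow_eq (c := squareCoords n),
    hrow, hcol] at key
  rw [ShapeCoords.minAbove_eq (c := squareCoords n), ShapeCoords.maxBelow_eq (c := squareCoords n),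
    hE, hE, hE, hE, min_comm, max_comm]
  exact key

theorem transpose_iterate_rowmotion_rowmotion {m : ℕ} {σ : PPartition (Rectangle n n) m}
    (h : (PPartition.rowmotion^[n] σ).transpose = σ) :
    (PPartition.rowmotion^[n] σ.rowmotion).transpose = σ.rowmotion := by
  rw [← Function.iterate_succ_apply, Function.iterate_succ_apply', transpose_rowmotion, h]

/-- On the antidiagonal, the symmetry condition and reciprocity give `2 * σ i j = 2 * M`. -/
theorem entry_antidiagonal {σ : PPartition (Rectangle n n) (2 * M)}
    (h : (PPartition.rowmotion^[n] σ).transpose = σ) {i j : ℕ} (hi : 1 ≤ i) (hj : 1 ≤ j)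
    (hij : i + j = n + 1) : E σ i j = M := by
  obtain ⟨i, rfl⟩ := Nat.exists_eq_add_of_le' hi
  have key := entry_iterate_rowmotion_add σ (i := i) (i' := j) (j := j) (j' := i + 1) (by omega)
    hj (by omega) hj hi
  rw [show i + j = n by omega, ← entry_transpose _ hi (by omega) hj (by omega), h] at key
  omega

theorem le_entry_of_add_le {σ : PPartition (Rectangle n n) (2 * M)}
    (h : (PPartition.rowmotion^[n] σ).transpose = σ) {i j : ℕ} (hij : i + j ≤ n + 1) :
    M ≤ E σ i j := by
  by_cases h0 : i = 0 ∨ j = 0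
  · rw [ShapeCoords.entry_of_eq_zero _ h0]
    omega
  · exact (entry_antidiagonal h (i := i) (j := n + 1 - i) (by omega) (by omega) (by omega)).ge.trans
      (ShapeCoords.entry_anti σ le_rfl (by omega))

/-- The `P`-partition of the triangle obtained by subtracting `M` from the entries of a plane
partition above the antidiagonal, with entries less than `M` replaced by `0`. -/
noncomputable def restrictTriangle (σ : PPartition (Rectangle n n) (2 * M)) :
    PPartition (WideTriangle (n - 1)) M where
  toFun p := E σ ((triangleCoords (n - 1)).row p) ((triangleCoords (n - 1)).col p) - M
  monotone p q h := by
    obtain ⟨h1, h2⟩ := ((triangleCoords (n - 1)).le_iff p q).1 h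
    exact Nat.sub_le_sub_right (ShapeCoords.entry_anti σ h1 h2) M
  le_height p := by
    have := ShapeCoords.entry_le (c := squareCoords n) σ ((triangleCoords (n - 1)).row p)
      ((triangleCoords (n - 1)).col p)
    omega

theorem entry_restrictTriangle {σ : PPartition (Rectangle n n) (2 * M)}
    (h : (PPartition.rowmotion^[n] σ).transpose = σ) {i j : ℕ} (hij : i + j ≤ n + 1) :
    T (restrictTriangle σ) i j = E σ i j - M := by
  by_cases h0 : i = 0 ∨ j = 0
  · rw [ShapeCoords.entry_of_eq_zero _ h0, ShapeCoords.entry_of_eq_zero _ h0]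
    omega
  by_cases h1 : i + j = n + 1
  · rw [entry_antidiagonal h (by omega) (by omega) h1,
      entry_triangle_of_lt _ (by omega) (by omega) (by omega), Nat.sub_self]
  · obtain ⟨p, rfl, rfl⟩ := exists_triangleCoords (k := n - 1) (i := i) (j := j) (by omega)
      (by omega) (by omega)
    rw [ShapeCoords.entry_coords]
    rfl

/-- As the antidiagonal keeps the value `M` under rowmotion, the part above it evolves as a
`P`-partition of the triangle. -/
theorem restrictTriangle_rowmotion {σ : PPartition (Rectangle n n) (2 * M)}
    (h : (PPartition.rowmotion^[n] σ).transpose = σ) :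
    restrictTriangle σ.rowmotion = (restrictTriangle σ).rowmotion := by
  refine PPartition.eq_rowmotion _ _ fun p => ?_
  have h' := transpose_iterate_rowmotion_rowmotion h
  have h1 := triangleCoords_add_le p
  have h2 := (triangleCoords (n - 1)).one_le_row p
  have h3 := (triangleCoords (n - 1)).one_le_col p
  rw [ShapeCoords.minAbove_eq (c := triangleCoords (n - 1)),
    ShapeCoords.maxBelow_eq (c := triangleCoords (n - 1)),
    ← ShapeCoords.entry_coords (c := triangleCoords (n - 1)),
    ← ShapeCoords.entry_coords (c := triangleCoords (n - 1))]
  generalize (triangleCoords (n - 1)).row p = i at *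
  generalize (triangleCoords (n - 1)).col p = j at *
  obtain ⟨q, rfl, rfl⟩ := exists_squareCoords (n := n) (i := i) (j := j) h2 (by omega) h3
    (by omega)
  have key := (squareCoords n).entry_rowmotion σ q
  generalize (squareCoords n).row q = i at *
  generalize (squareCoords n).col q = j at *
  rw [entry_restrictTriangle h' (by omega), entry_restrictTriangle h (by omega),
    entry_restrictTriangle h' (by omega), entry_restrictTriangle h' (by omega),
    entry_restrictTriangle h (by omega), entry_restrictTriangle h (by omega)]
  have a1 := le_entry_of_add_le h' (i := i) (j := j) (by omega)
  have a2 := le_entry_of_add_le h (i := i) (j := j) (by omega)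
  have a3 := le_entry_of_add_le h' (i := i - 1) (j := j) (by omega)
  have a4 := le_entry_of_add_le h' (i := i) (j := j - 1) (by omega)
  have a5 := le_entry_of_add_le h (i := i + 1) (j := j) (by omega)
  have a6 := le_entry_of_add_le h (i := i) (j := j + 1) (by omega)
  omega

theorem restrictTriangle_iterate_rowmotion {σ : PPartition (Rectangle n n) (2 * M)}
    (h : (PPartition.rowmotion^[n] σ).transpose = σ) (t : ℕ) :
    (PPartition.rowmotion^[n] (PPartition.rowmotion^[t] σ)).transpose =
        PPartition.rowmotion^[t] σ ∧
      restrictTriangle (PPartition.rowmotion^[t] σ) =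
        PPartition.rowmotion^[t] (restrictTriangle σ) := by
  induction t with
  | zero => exact ⟨h, rfl⟩
  | succ t ih =>
    rw [Function.iterate_succ_apply', Function.iterate_succ_apply']
    exact ⟨transpose_iterate_rowmotion_rowmotion ih.1,
      by rw [restrictTriangle_rowmotion ih.1, ih.2]⟩

theorem wing_restrictTriangle {σ : PPartition (Rectangle n n) (2 * M)}
    (h : (PPartition.rowmotion^[n] σ).transpose = σ) : wing n (restrictTriangle σ) = σ := by
  refine (squareCoords n).ppartition_ext fun p => ?_
  have h1 := squareCoords_row_le p
  have h2 := squareCoords_col_le p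
  have h3 := (squareCoords n).one_le_row p
  have h4 := (squareCoords n).one_le_col p
  rw [entry_wing _ (by omega) (by omega)]
  generalize (squareCoords n).row p = i at *
  generalize (squareCoords n).col p = j at *
  by_cases hij : i + j ≤ n + 1
  · rw [wingEntry_of_le _ hij, entry_restrictTriangle h hij]
    have := le_entry_of_add_le h hij
    omega
  · obtain ⟨r, hr⟩ : ∃ r, i + j = n + 1 + r := ⟨i + j - (n + 1), by omega⟩
    obtain ⟨ht, hrt⟩ := restrictTriangle_iterate_rowmotion h r
    rw [wingEntry_of_ge _ h3 h1 h4 hr, ← hrt, entry_restrictTriangle ht (by omega)]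
    -- Below the antidiagonal, reciprocity at `(n + 1 - j, n + 1 - i)` determines the entries.
    have key := entry_iterate_rowmotion_add (PPartition.rowmotion^[r] σ) (i := n - j) (i' := j)
      (j := n + 1 - i) (j' := i) (by omega) h4 (by omega) (by omega) h3
    rw [← Function.iterate_add_apply, show n - j + (n + 1 - i) + r = n by omega,
      ← entry_transpose _ h3 h1 h4 h2, h, show n - j + 1 = n + 1 - j by omega] at key
    have := le_entry_of_add_le ht (i := n + 1 - j) (j := n + 1 - i) (by omega)
    omega

theorem restrictTriangle_wing (π : PPartition (WideTriangle (n - 1)) M) :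
    restrictTriangle (wing n π) = π := by
  refine (triangleCoords (n - 1)).ppartition_ext fun p => ?_
  have h1 := triangleCoords_add_le p
  have h2 := (triangleCoords (n - 1)).one_le_row p
  have h3 := (triangleCoords (n - 1)).one_le_col p
  rw [entry_restrictTriangle (transpose_iterate_rowmotion_wing π) (by omega),
    entry_wing _ (by omega) (by omega), wingEntry_of_le _ (by omega), Nat.add_sub_cancel_left]

end Restriction

theorem mainTheorem10 (n M : ℕ) (hn : 1 ≤ n) :
    ∃ f : PPartition (WideTriangle (n - 1)) M ≃
        {π : PPartition (Rectangle n n) (2 * M) //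
          PPartition.transpose (PPartition.rowmotion^[n] π) = π},
      ∀ π : PPartition (WideTriangle (n - 1)) M,
        (f (PPartition.rowmotion π) : PPartition (Rectangle n n) (2 * M)) =
          PPartition.rowmotion (f π : PPartition (Rectangle n n) (2 * M)) := by
  exact ⟨{ toFun := fun π => ⟨wing n π, transpose_iterate_rowmotion_wing π⟩
           invFun := fun σ => restrictTriangle σ.1
           left_inv := restrictTriangle_wing
           right_inv := fun σ => Subtype.ext (wing_restrictTriangle σ.2) }, wing_rowmotion⟩
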